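/- Let $V$ be a complete Hausdorff locally convex real topological vector space (for instance a Banach space, or the Schwartz space $\mathcal S(\mathbb R^d,\mathbb C)$ as a real space, on which unbounded operators such as $\tfrac{\mathrm i\varepsilon}{2}\Delta$ act continuously). Derivatives $G'(x)h=\tfrac{d}{ds}G(x+sh)|_{s=0}$ are real directional derivatives, $G''(x)(h,k)$ is the derivative of $x\mapsto G'(x)h$ in the direction $k$, and $C^n$ is understood in the Michal–Bastiani sense ($C^{n+1}$: $G$ is continuous, $G'(x)h$ exists everywhere and $(x,h)\mapsto G'(x)h$ is $C^n$); integrals of curves are weak integrals (tested with all continuous linear functionals). Let $A:V\to V$ be linear and continuous, $B:V\to V$ of class $C^3$ (possibly nonlinear), and $F=A+B$. Let $\mathcal E_A(t)$ be the one-parameter group of continuous linear operators generated by $A$ (jointly $C^3$), and let $\mathcal E_B(t,u)$ and $\mathcal E_F(t,u)$ be the local flows of $\psi'=B(\psi)$ and $\psi'=F(\psi)$, jointly of class $C^3$ and $C^2$, respectively, on open flow domains in $\mathbb R\times V$. Write $\partial_2$ for the derivative with respect to the initial value, and $$[G,H](u)=G'(u)H(u)-H'(u)G(u),\qquad [A,B'(x)](h)=A\,B'(x)h-B'(x)\,A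 h .$$ Let $$\mathcal S(t,u)=\mathcal E_A(\tfrac t2)\,\mathcal E_B\big(t,\mathcal E_A(\tfrac t2)u\big),\qquad \mathcal L(t,u)=\mathcal S(t,u)-\mathcal E_F(t,u),$$ $$\mathcal S^{(1)}(t,u)=\partial_t\mathcal S(t,u)-F(\mathcal S(t,u)),\qquad \mathcal S^{(2)}(t,u)=\partial_t\mathcal S^{(1)}(t,u)-F'(\mathcal S(t,u))\,\mathcal S^{(1)}(t,u).$$ Fix $u\in V$ and $T$ such that $\mathcal E_B(t,\mathcal E_A(\tfrac t2)u)$ and $\mathcal E_F(t-\tau,\mathcal S(\tau,u))$ are defined for $0\le\tau\le t\le T$. Then the time derivatives above exist for $0\le t\le T$, and the following hold for all such $t$. (i) $\displaystyle \mathcal L(t,u)=\int_0^t\!\int_0^{\tau_1}\Big\{\partial_2\mathcal E_F(t-\tau_2,\mathcal S(\tau_2,u))\,\mathcal S^{(2)}(\tau_2,u)+\partial_2^2\mathcal E_F(t-\tau_2,\mathcal S(\tau_2,u))\big(\mathcal S^{(1)}(\tau_2,u),\mathcal S^{(1)}(\tau_2,u)\big)\Big\}\,d\tau_2\,d\tau_1,$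 and the double integrals of the two summands exist separately and add up to $\mathcal L(t,u)$. (ii) With $v=\mathcal E_A(\tfrac t2)u$ and $w=\mathcal E_B(t,v)$, $\mathcal S^{(1)}(t,u)=\int_0^t s_1(t,\tau,u)\,d\tau$, where $$s_1(t,\tau,u)=\tfrac12\mathcal E_A(\tfrac{t-\tau}2)\,[A,B]\big(\mathcal E_A(\tfrac\tau2)w\big)+\tfrac12\mathcal E_A(\tfrac t2)\,\partial_2\mathcal E_B(t-\tau,\mathcal E_B(\tau,v))\,[B,A]\big(\mathcal E_B(\tau,v)\big).$$ (iii) With in addition $x=\mathcal E_A(\tfrac\tau2)w$, $y=\mathcal E_B(\tau,v)$, $d_t=\partial_2\mathcal E_B(t,v)Av-A\,\mathcal E_B(t,v)$ and $d_\tau=\partial_2\mathcal E_B(\tau,v)Av-A\,\mathcal E_B(\tau,v)$, one has $\mathcal S^{(2)}(t,u)=\int_0^t s_2(t,\tau,u)\,d\tau$, where $$\begin{aligned}s_2(t,\tau,u)={}&-\tfrac12\mathcal E_A(\tfrac{t-\tau}2)\,B''(x)\big(Ax,\mathcal E_A(\tfrac\tau2)d_t\big)+\tfrac12\mathcal E_A(\tfrac{t-\tau}2)\Big([A,[B,A]](x)+[A,B'(x)]\,\mathcal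 E_A(\tfrac\tau2)d_t\Big)\\&+\mathcal E_A(\tfrac{t-\tau}2)\Big(-B''(x)\big(\mathcal E_A(\tfrac\tau2)B(w)-B(x),Ax\big)+\tfrac12[B,[B,A]](x)+[A,B'(x)]\big(\mathcal E_A(\tfrac\tau2)B(w)-B(x)\big)\Big)\\&+\mathcal E_A(\tfrac t2)\,\partial_2\mathcal E_B(t-\tau,y)\Big(\tfrac14[A,[A,B]](y)-\tfrac12[A,B'(y)]\,d_\tau+\tfrac14B''(y)\big(d_\tau,\partial_2\mathcal E_B(\tau,v)Av+Ay\big)\Big).\end{aligned}$$ (iv) For every continuous seminorm $p$ on $V$ there is a constant $C$ (depending on $p$, $u$, $T$ and the data, but not on $t,\tau$) such that, with $\ell(u)=\tfrac14[A,[B,A]](u)+\tfrac12[B,[B,A]](u)$, for all $0\le\tau\le t\le T$ $$p\big(\mathcal S^{(1)}(t,u)\big)\le C\,t,\qquad p\big(s_2(t,\tau,u)-\ell(u)\big)\le C\,t,\qquad p\Big(\mathcal L(t,u)-\tfrac{t^3}{6}\,\ell(u)\Big)\le C\,t^4 .$$ -/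

import Mathlib

open Set Filter Topology MeasureTheory

universe u v

namespace StrangSplitting

noncomputable section

/-! ### Differential calculus in locally convex spaces -/

section Calculus

variable {E : Type u} [AddCommGroup E] [Module ℝ E]
variable {F : Type v} [AddCommGroup F] [Module ℝ F] [TopologicalSpace F]

/-- The derivative `G'(x) h` of `G` at `x` in the direction `h` (over the reals). For maps of class
`C¹` it is continuous and linear in `h`; in Banach spaces it is the Fréchet derivative
whenever the latter exists. -/
def D (G : E → F) (x h : E) : F :=
  deriv (fun s : ℝ => G (x + s • h)) 0

/-- The second derivative `G''(x)(h, k)`. -/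
def D2 (G : E → F) (x h k : E) : F :=
  D (fun y => D G y h) x k

variable (F) in
/-- `CnOn F n G U`: the map `G` is of class `Cⁿ` (in the sense of Michal and Bastiani) on the open
set `U` of a topological vector space. `C⁰` means continuous; `Cⁿ⁺¹` means that `G` is continuous,
that all directional derivatives `D G x h` (`x ∈ U`) exist, and that `(x, h) ↦ D G x h` is
of class `Cⁿ` on `U × E`. A map between Banach spaces that is `n` times continuously
Fréchet differentiable is of class `Cⁿ` in this sense, and the two notions agree for `C^∞`. -/
def CnOn : ℕ → ∀ {E : Type u} [AddCommGroup E] [Module ℝ E] [TopologicalSpace E],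
    (E → F) → Set E → Prop
  | 0, _, _, _, _, G, U => ContinuousOn G U
  | n + 1, E, _, _, _, G, U =>
      ContinuousOn G U ∧
      (∀ x ∈ U, ∀ h : E, DifferentiableAt ℝ (fun s : ℝ => G (x + s • h)) 0) ∧
      CnOn n (fun p : E × E => D G p.1 p.2) (U ×ˢ (univ : Set E))

end Calculus

/-! ### Integrals of curves -/

section Integral

variable {V : Type u} [AddCommGroup V] [Module ℝ V] [TopologicalSpace V]

/-- `I = ∫ₐᵇ f(τ) dτ` for a curve `f` in a Hausdorff locally convex space: `φ ∘ f` is integrable and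
`φ I = ∫ₐᵇ φ(f(τ)) dτ` for every continuous linear functional `φ`. Such an `I` is unique. -/
def IsIntegral (f : ℝ → V) (a b : ℝ) (I : V) : Prop :=
  ∀ φ : V →L[ℝ] ℝ, IntervalIntegrable (fun τ => φ (f τ)) volume a b ∧
    ∫ τ in a..b, φ (f τ) = φ I

/-- `I = ∫₀ᵗ ∫₀^{τ₁} f(τ₂) dτ₂ dτ₁`. -/
def IsDoubleIntegral (f : ℝ → V) (t : ℝ) (I : V) : Prop :=
  ∃ g : ℝ → V, (∀ τ₁ ∈ Icc (0 : ℝ) t, IsIntegral f 0 τ₁ (g τ₁)) ∧ IsIntegral g 0 t I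

end Integral

/-! ### Flows -/

/-- `E` is the (local) flow of the evolution equation `ψ' = G(ψ)`, of class `Cⁿ`, with flow domain
`Dom`: for each initial value `u`, the set of `t` with `(t, u) ∈ Dom` is an interval around `0`
on which `t ↦ E t u` solves the equation with `E 0 u = u`. Global flows have `Dom = univ`. -/
structure IsFlow {V : Type u} [AddCommGroup V] [Module ℝ V] [TopologicalSpace V]
    [ContinuousSMul ℝ V] (n : ℕ) (G : V → V) (Dom : Set (ℝ × V)) (E : ℝ → V → V) : Prop where
  isOpen : IsOpen Dom
  zero_mem : ∀ u, ((0 : ℝ), u) ∈ Dom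
  interval : ∀ u, {t : ℝ | (t, u) ∈ Dom}.OrdConnected
  smooth : CnOn V n (fun p : ℝ × V => E p.1 p.2) Dom
  zero : ∀ u, E 0 u = u
  ode : ∀ t u, (t, u) ∈ Dom → HasDerivAt (fun s => E s u) (G (E t u)) t
  mem_iff : ∀ s t u, (s, u) ∈ Dom → ((t, E s u) ∈ Dom ↔ (t + s, u) ∈ Dom)
  add : ∀ s t u, (s, u) ∈ Dom → (t, E s u) ∈ Dom → E (t + s) u = E t (E s u)

/-! ### Commutators, the Strang splitting step and its defects -/

section Strang

variable {V : Type u} [AddCommGroup V] [Module ℝ V] [TopologicalSpace V]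

/-- The commutator `[G, H](u) = G'(u) H(u) - H'(u) G(u)` of two nonlinear vector fields. -/
def comm (G H : V → V) (u : V) : V :=
  D G u (H u) - D H u (G u)

/-- `[A, B'(x)](h) = A B'(x) h - B'(x) A h` for linear `A`. -/
def commD (A : V →L[ℝ] V) (B : V → V) (x h : V) : V :=
  A (D B x h) - D B x (A h)

/-- The Strang splitting step `S(t, u) = E_A(t/2) E_B(t, E_A(t/2) u)`. -/
def step (EA : ℝ → V →L[ℝ] V) (EB : ℝ → V → V) (t : ℝ) (u : V) : V :=
  EA (t / 2) (EB t (EA (t / 2) u))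

/-- The local error `L(t, u) = S(t, u) - E_F(t, u)`. -/
def localError (EA : ℝ → V →L[ℝ] V) (EB EF : ℝ → V → V) (t : ℝ) (u : V) : V :=
  step EA EB t u - EF t u

/-- The right-hand side `F = A + B`. -/
def field (A : V →L[ℝ] V) (B : V → V) (u : V) : V :=
  A u + B u

/-- The first-order defect `S₁(t, u) = ∂ₜ S(t, u) - F(S(t, u))`. -/
def S1 (A : V →L[ℝ] V) (B : V → V) (EA : ℝ → V →L[ℝ] V) (EB : ℝ → V → V) (t : ℝ) (u : V) : V :=
  deriv (fun s : ℝ => step EA EB s u) t - field A B (step EA EB t u)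

/-- The second-order defect `S₂(t, u) = ∂ₜ S₁(t, u) - F'(S(t, u)) S₁(t, u)`. -/
def S2 (A : V →L[ℝ] V) (B : V → V) (EA : ℝ → V →L[ℝ] V) (EB : ℝ → V → V) (t : ℝ) (u : V) : V :=
  deriv (fun s : ℝ => S1 A B EA EB s u) t
    - D (field A B) (step EA EB t u) (S1 A B EA EB t u)

/-- The integrand `s₁(t, τ, u)` of the integral representation of `S₁(t, u)`. -/
def s1 (A : V →L[ℝ] V) (B : V → V) (EA : ℝ → V →L[ℝ] V) (EB : ℝ → V → V) (t τ : ℝ) (u : V) : V :=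
  let v := EA (t / 2) u
  let w := EB t v;
  (1 / 2 : ℝ) • EA ((t - τ) / 2) (comm A B (EA (τ / 2) w))
    + (1 / 2 : ℝ) • EA (t / 2) (D (EB (t - τ)) (EB τ v) (comm B A (EB τ v)))

/-- The integrand `s₂(t, τ, u)` of the integral representation of `S₂(t, u)`. -/
def s2 (A : V →L[ℝ] V) (B : V → V) (EA : ℝ → V →L[ℝ] V) (EB : ℝ → V → V) (t τ : ℝ) (u : V) : V :=
  let v := EA (t / 2) u
  let w := EB t v
  let x := EA (τ / 2) w
  let y := EB τ v
  let dt := D (EB t) v (A v) - A w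
  let dτ := D (EB τ) v (A v) - A y;
  -((1 / 2 : ℝ) • EA ((t - τ) / 2) (D2 B x (A x) (EA (τ / 2) dt)))
    + (1 / 2 : ℝ) • EA ((t - τ) / 2)
        (comm A (comm B A) x + commD A B x (EA (τ / 2) dt))
    + EA ((t - τ) / 2)
        (-(D2 B x (EA (τ / 2) (B w) - B x) (A x))
          + (1 / 2 : ℝ) • comm B (comm B A) x
          + commD A B x (EA (τ / 2) (B w) - B x))
    + EA (t / 2) (D (EB (t - τ)) y
        ((1 / 4 : ℝ) • comm A (comm A B) y
          - (1 / 2 : ℝ) • commD A B y dτ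
          + (1 / 4 : ℝ) • D2 B y dτ (D (EB τ) v (A v) + A y)))

/-- The leading term `(1/4) [A, [B, A]](u) + (1/2) [B, [B, A]](u)`. -/
def leading (A : V →L[ℝ] V) (B : V → V) (u : V) : V :=
  (1 / 4 : ℝ) • comm A (comm B A) u + (1 / 2 : ℝ) • comm B (comm B A) u

end Strang

end

end StrangSplitting

/-! The local error is a telescoping difference. The curve `τ ↦ E_F(t-τ, S(τ,u))` runs from
`E_F(t,u)` to `S(t,u)`. A linearized flow transports its own vector field (`IsFlow.D_field`), so the
`F`-part of `∂_τ S` cancels and the velocity is `∂₂E_F(t-τ,S) S⁽¹⁾`. This velocity vanishes at `τ =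
0`, because `S⁽¹⁾(0,u) = 0`. Differentiating it once more, with the variational equation and the
symmetry of second derivatives, gives exactly the integrand of (i). Two applications of the
fundamental theorem of calculus prove (i) (`isDoubleIntegral_localError`).

The representations (ii) and (iii) come from explicit primitives in `τ`. Curves such as
`E_A((t-τ)/2) B(E_A(τ/2)w)` and `∂₂E_B(t-τ,y) A y` have commutators as derivatives, and their
boundary values combine to the closed forms `S1_eq` and `S2_eq`.

For (iv), `s₂` is jointly `C¹` in `(t,τ)` and equals `ℓ(u)` at the origin, so compactness of the
time simplices gives `s₂ = ℓ(u) + O(t)`. Pulling `∂₂E_F` under the integral for `S⁽²⁾` gives `∂₂E_F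
S⁽²⁾(τ) = τ ℓ(u) + O(tτ)`, while `S⁽¹⁾ = O(τ)` makes the quadratic term `O(τ²)`. Double integration
of `τ ℓ(u)` yields `t³/6 ℓ(u)`, and the remainder is `O(t⁴)`.

Everything takes place in a locally convex space. There the calculus rests on a mean value theorem
obtained from Hahn–Banach (`sub_mem_of_hasDerivAt`) and on joint difference quotients
(`CnOn.tendsto_slope`), which yield linearity of derivatives, the chain rule and symmetry. -/

set_option linter.unusedSectionVars false

namespace StrangSplitting

/-! ### Differentiable curves in topological vector spaces. -/

section Curves

variable {E : Type*} [AddCommGroup E] [Module ℝ E] [TopologicalSpace E]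
  [IsTopologicalAddGroup E] [ContinuousSMul ℝ E]
variable {F : Type*} [AddCommGroup F] [Module ℝ F] [TopologicalSpace F]
  [IsTopologicalAddGroup F] [ContinuousSMul ℝ F]
variable {f g : ℝ → E} {f' g' : E} {x : ℝ}

/-- Without a norm, `HasDerivAt` is a little-o relation between filters. Over `ℝ` it becomes
convergence of the rescaled remainder; puncturing the neighbourhood loses nothing, as that remainder
is `0` at `s = 0`. -/
theorem hasDerivAt_iff_tendsto_inv_smul :
    HasDerivAt f f' x ↔ Tendsto (fun s => s⁻¹ • (f (x + s) - f x)) (𝓝[≠] 0) (𝓝 f') := by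
  have h1 : HasDerivAt f f' x ↔
      Tendsto (fun s => s⁻¹ • (f (x + s) - f x - s • f')) (𝓝 0) (𝓝 0) := by
    rw [hasDerivAt_iff_hasFDerivAt, HasFDerivAt, hasFDerivAtFilter_iff_isLittleOTVS,
      Asymptotics.isLittleOTVS_iff_tendsto_inv_smul, prod_pure, tendsto_map'_iff]
    · have : 𝓝 x = map (fun s => x + s) (𝓝 0) := by simp
      rw [this, tendsto_map'_iff]
      simp [Function.comp_def]
    · rw [prod_pure, eventually_map]
      refine Eventually.of_forall fun a ha => ?_
      have : a = x := sub_eq_zero.1 ha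
      simp [this]
  have h2 : Tendsto (fun s => s⁻¹ • (f (x + s) - f x - s • f')) (𝓝 0) (𝓝 0) ↔
      Tendsto (fun s => s⁻¹ • (f (x + s) - f x - s • f')) (𝓝[≠] 0) (𝓝 0) := by
    rw [← nhdsNE_sup_pure, tendsto_sup]
    refine and_iff_left (tendsto_pure_left.2 fun s hs => ?_)
    simpa using mem_of_mem_nhds hs
  rw [h1, h2]
  have h3 : Tendsto (fun s => s⁻¹ • (f (x + s) - f x - s • f')) (𝓝[≠] 0) (𝓝 0) ↔
      Tendsto (fun s => s⁻¹ • (f (x + s) - f x) - f') (𝓝[≠] 0) (𝓝 0) := by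
    refine tendsto_congr' ?_
    filter_upwards [self_mem_nhdsWithin] with s hs
    rw [smul_sub _ _ (s • f'), inv_smul_smul₀ hs]
  rw [h3]
  exact tendsto_sub_nhds_zero_iff

theorem hasDerivAt_const_tvs (c : E) (x : ℝ) : HasDerivAt (fun _ : ℝ => c) 0 x := by
  rw [hasDerivAt_iff_tendsto_inv_smul]
  simpa using tendsto_const_nhds

theorem _root_.HasDerivAt.tvs_add (hf : HasDerivAt f f' x) (hg : HasDerivAt g g' x) :
    HasDerivAt (fun s => f s + g s) (f' + g') x := by
  rw [hasDerivAt_iff_tendsto_inv_smul] at *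
  refine (hf.add hg).congr fun s => ?_
  rw [← smul_add]; congr 1; abel

theorem _root_.HasDerivAt.tvs_comp_clm (hf : HasDerivAt f f' x) (L : E →L[ℝ] F) :
    HasDerivAt (fun s => L (f s)) (L f') x := by
  rw [hasDerivAt_iff_tendsto_inv_smul] at *
  exact ((L.continuous.tendsto _).comp hf).congr fun s => by simp

theorem _root_.HasDerivAt.tvs_neg (hf : HasDerivAt f f' x) :
    HasDerivAt (fun s => -f s) (-f') x :=
  hf.tvs_comp_clm (-ContinuousLinearMap.id ℝ E)

theorem _root_.HasDerivAt.tvs_sub (hf : HasDerivAt f f' x) (hg : HasDerivAt g g' x) :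
    HasDerivAt (fun s => f s - g s) (f' - g') x := by
  simpa only [sub_eq_add_neg] using hf.tvs_add hg.tvs_neg

theorem _root_.HasDerivAt.tvs_const_smul (hf : HasDerivAt f f' x) (c : ℝ) :
    HasDerivAt (fun s => c • f s) (c • f') x :=
  hf.tvs_comp_clm (c • ContinuousLinearMap.id ℝ E)

theorem _root_.HasDerivAt.tvs_prodMk {g : ℝ → F} {g' : F} (hf : HasDerivAt f f' x)
    (hg : HasDerivAt g g' x) : HasDerivAt (fun s => (f s, g s)) (f', g') x := by
  rw [hasDerivAt_iff_tendsto_inv_smul] at *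
  exact (hf.prodMk_nhds hg).congr fun s => rfl

theorem _root_.HasDerivAt.tvs_continuousAt (hf : HasDerivAt f f' x) : ContinuousAt f x :=
  HasFDerivAt.continuousAt hf


theorem _root_.HasDerivAt.tvs_congr (hf : HasDerivAt f f' x) (h : g =ᶠ[𝓝 x] f) :
    HasDerivAt g f' x :=
  HasFDerivAt.congr_of_eventuallyEq hf h

theorem _root_.HasDerivAt.tvs_unique [T2Space E] (hf : HasDerivAt f f' x)
    (hg : HasDerivAt f g' x) : f' = g' := by
  rw [hasDerivAt_iff_tendsto_inv_smul] at *
  exact tendsto_nhds_unique hf hg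

theorem _root_.HasDerivAt.tvs_deriv [T2Space E] (hf : HasDerivAt f f' x) : deriv f x = f' := by
  have h : HasDerivAt f (deriv f x) x := by
    have := (HasFDerivAt.differentiableAt hf).hasFDerivAt
    rwa [hasFDerivAt_iff_hasDerivAt] at this
  exact h.tvs_unique hf

/-- Difference quotients cannot simply be multiplied, since `c` may return to the value `c x` near
`x`; the argument adds little-o remainders instead. -/
theorem _root_.HasDerivAt.tvs_scomp {c : ℝ → ℝ} {c' : ℝ} (hf : HasDerivAt f f' (c x))
    (hc : HasDerivAt c c' x) : HasDerivAt (fun s => f (c s)) (c' • f') x := by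
  rw [hasDerivAt_iff_hasFDerivAt] at *
  have hL : Tendsto (Prod.map c c) (𝓝 x ×ˢ pure x) (𝓝 (c x) ×ˢ pure (c x)) :=
    hc.continuousAt.tendsto.prodMap (tendsto_pure_pure _ _)
  have h1 := ((HasFDerivAtFilter.isLittleOTVS hf).comp_tendsto hL).trans_isBigOTVS
    (HasFDerivAtFilter.isBigOTVS_sub hc)
  have h2 := ((ContinuousLinearMap.toSpanSingleton ℝ f').isBigOTVS_comp
    (l := 𝓝 x ×ˢ pure x)).trans_isLittleOTVS
    (HasFDerivAtFilter.isLittleOTVS hc)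
  refine HasFDerivAtFilter.of_isLittleOTVS ((h1.add h2).congr_left fun p => ?_)
  simp [sub_smul, mul_smul]

/-- Mean value theorem: the increment of a curve lies in every closed convex set that contains
its velocities. -/
theorem sub_mem_of_hasDerivAt [LocallyConvexSpace ℝ E] {C : Set E} (hC : Convex ℝ C)
    (hC' : IsClosed C) {f' : ℝ → E} (hf : ∀ r ∈ Icc (0 : ℝ) 1, HasDerivAt f (f' r) r)
    (hm : ∀ r ∈ Icc (0 : ℝ) 1, f' r ∈ C) : f 1 - f 0 ∈ C := by
  by_contra h
  -- A functional separating the increment from `C` would contradict the scalar mean value theorem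
  -- for `φ ∘ f`.
  obtain ⟨φ, c, h1, h2⟩ := geometric_hahn_banach_closed_point hC hC' h
  obtain ⟨r, hr, h3⟩ := exists_hasDerivAt_eq_slope (fun s => φ (f s)) (fun s => φ (f' s))
    zero_lt_one (fun s hs => ((hf s hs).tvs_comp_clm φ).continuousAt.continuousWithinAt)
    (fun s hs => (hf s (Ioo_subset_Icc_self hs)).tvs_comp_clm φ)
  have h4 := h1 _ (hm r (Ioo_subset_Icc_self hr))
  simp only [map_sub] at h2
  simp only [sub_zero, div_one] at h3
  linarith

/-- Limits can be tested on closed convex neighbourhoods, the sets to which the mean value theorem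
applies. -/
theorem exists_isClosed_convex_mem_nhds [LocallyConvexSpace ℝ E] {y : E} {N : Set E}
    (hN : N ∈ 𝓝 y) : ∃ C ∈ 𝓝 y, IsClosed C ∧ Convex ℝ C ∧ C ⊆ N := by
  obtain ⟨N', h1, h2, h3⟩ := exists_mem_nhds_isClosed_subset hN
  obtain ⟨K, ⟨hK, hK'⟩, hK2⟩ :=
    (LocallyConvexSpace.convex_basis (𝕜 := ℝ) y).mem_iff.1 h1
  exact ⟨closure K, mem_of_superset hK subset_closure, isClosed_closure, hK'.closure,
    (closure_minimal hK2 h2).trans h3⟩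

end Curves

/-! ### Michal–Bastiani calculus: difference quotients, chain rule, linearity. -/

section Calculus

variable {E : Type*} [AddCommGroup E] [Module ℝ E] [TopologicalSpace E]
  [IsTopologicalAddGroup E] [ContinuousSMul ℝ E]
variable {F : Type*} [AddCommGroup F] [Module ℝ F] [TopologicalSpace F]
  [IsTopologicalAddGroup F] [ContinuousSMul ℝ F]
variable {G H : E → F} {U W : Set E} {n : ℕ} {x h k : E}

theorem hasDerivAt_D (hG : DifferentiableAt ℝ (fun s : ℝ => G (x + s • h)) 0) :
    HasDerivAt (fun s : ℝ => G (x + s • h)) (D G x h) 0 := by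
  have := hG.hasFDerivAt
  rwa [hasFDerivAt_iff_hasDerivAt] at this

theorem D_eq_of_hasDerivAt [T2Space F] {d : F}
    (hd : HasDerivAt (fun s : ℝ => G (x + s • h)) d 0) : D G x h = d :=
  hd.tvs_deriv

theorem hasDerivAt_line_iff {d : F} {r : ℝ} :
    HasDerivAt (fun s : ℝ => G (x + s • h)) d r ↔
      HasDerivAt (fun s : ℝ => G ((x + r • h) + s • h)) d 0 := by
  simp only [hasDerivAt_iff_tendsto_inv_smul, zero_add, zero_smul, add_zero, add_smul, add_assoc]

theorem hasDerivAt_add_smul (x h : E) (r : ℝ) : HasDerivAt (fun s : ℝ => x + s • h) h r := by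
  have := (hasDerivAt_const_tvs x r).tvs_add
    ((hasDerivAt_id r).tvs_comp_clm (ContinuousLinearMap.toSpanSingleton ℝ h))
  simpa using this

theorem CnOn.continuousOn (hG : CnOn F n G U) : ContinuousOn G U := by
  cases n
  · exact hG
  · exact hG.1

theorem CnOn.mono (hG : CnOn F n G U) (hW : W ⊆ U) : CnOn F n G W := by
  induction n generalizing E with
  | zero => exact ContinuousOn.mono hG hW
  | succ n ih =>
    exact ⟨hG.1.mono hW, fun x hx => hG.2.1 x (hW hx), ih hG.2.2 (prod_mono hW subset_rfl)⟩

theorem CnOn.of_succ (hG : CnOn F (n + 1) G U) : CnOn F n G U := by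
  induction n generalizing E with
  | zero => exact hG.1
  | succ n ih => exact ⟨hG.1, hG.2.1, ih hG.2.2⟩

theorem CnOn.of_le {m : ℕ} (hG : CnOn F n G U) (hm : m ≤ n) : CnOn F m G U := by
  induction n, hm using Nat.le_induction with
  | base => exact hG
  | succ n _ ih => exact ih hG.of_succ

theorem CnOn.hasDerivAt_line (hG : CnOn F (n + 1) G U) {r : ℝ} (hx : x + r • h ∈ U) :
    HasDerivAt (fun s : ℝ => G (x + s • h)) (D G (x + r • h) h) r :=
  hasDerivAt_line_iff.2 (hasDerivAt_D (hG.2.1 _ hx h))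

/-- Joint difference quotients of a `C¹` map, at moving base points and in moving directions. -/
theorem CnOn.tendsto_slope [LocallyConvexSpace ℝ F] (hG : CnOn F (n + 1) G U)
    (hU : IsOpen U) (hx : x ∈ U) {α : Type*} {l : Filter α} {y κ : α → E} {s : α → ℝ}
    (hy : Tendsto y l (𝓝 x)) (hκ : Tendsto κ l (𝓝 h)) (hs : Tendsto s l (𝓝 0))
    (hs0 : ∀ᶠ a in l, s a ≠ 0) :
    Tendsto (fun a => (s a)⁻¹ • (G (y a + s a • κ a) - G (y a))) l (𝓝 (D G x h)) := by
  intro N hN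
  obtain ⟨C, hC, hC1, hC2, hCN⟩ := exists_isClosed_convex_mem_nhds hN
  have hc : ContinuousAt (fun q : ℝ × E × E => D G (q.2.1 + q.1 • q.2.2) q.2.2) (0, x, h) := by
    have h1 : ContinuousAt (fun p : E × E => D G p.1 p.2) (x + (0 : ℝ) • h, h) := by
      refine hG.2.2.continuousOn.continuousAt ((hU.prod isOpen_univ).mem_nhds ?_)
      simpa using hx
    exact ContinuousAt.comp (f := fun q : ℝ × E × E => (q.2.1 + q.1 • q.2.2, q.2.2))
      (x := (0, x, h)) h1 (by fun_prop)
  have hu : ∀ᶠ q : ℝ × E × E in 𝓝 (0, x, h), q.2.1 + q.1 • q.2.2 ∈ U := by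
    have : ContinuousAt (fun q : ℝ × E × E => q.2.1 + q.1 • q.2.2) (0, x, h) := by fun_prop
    exact this.eventually (hU.mem_nhds (by simpa using hx))
  have hc' : ∀ᶠ q : ℝ × E × E in 𝓝 (0, x, h), D G (q.2.1 + q.1 • q.2.2) q.2.2 ∈ C :=
    hc.eventually (by simpa using hC)
  obtain ⟨P, hP, Q, hQ, hPQ⟩ := mem_nhds_prod_iff.1 (hu.and hc')
  obtain ⟨δ, hδ, hδP⟩ := Metric.mem_nhds_iff.1 hP
  rw [mem_map]
  refine mem_of_superset ?_ (preimage_mono hCN)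
  filter_upwards [(hy.prodMk_nhds hκ) hQ, hs0,
    hs.eventually (Metric.ball_mem_nhds (0 : ℝ) hδ)]
    with a ha ha0 haδ
  have hP' : ∀ r ∈ Icc (0 : ℝ) 1, y a + (r * s a) • κ a ∈ U ∧
      D G (y a + (r * s a) • κ a) (κ a) ∈ C := by
    intro r hr
    refine hPQ (Set.mk_mem_prod (hδP ?_) ha)
    simp only [Metric.mem_ball, dist_zero_right, Real.norm_eq_abs, abs_mul] at haδ ⊢
    rw [abs_of_nonneg hr.1]
    nlinarith [hr.2, abs_nonneg (s a)]
  -- Along the segment from `y a` to `y a + s a • κ a`, the rescaled curve has velocity `D G (·) (κ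
  -- a)`, which stays in `C`; its increment over `[0,1]` is the difference quotient.
  have key := sub_mem_of_hasDerivAt (f := fun r : ℝ => (s a)⁻¹ • G (y a + (r * s a) • κ a)) hC2 hC1
    (f' := fun r => D G (y a + (r * s a) • κ a) (κ a)) (fun r hr => ?_) (fun r hr => (hP' r hr).2)
  · simpa [smul_sub] using key
  · have h1 := (hG.hasDerivAt_line (hP' r hr).1).tvs_scomp (x := r) (c := fun r => r * s a)
      ((hasDerivAt_id r).mul_const (s a))
    simpa [inv_smul_smul₀ ha0] using h1.tvs_const_smul (s a)⁻¹

/-- Chain rule along a differentiable curve. -/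
theorem CnOn.hasDerivAt_comp [LocallyConvexSpace ℝ F] (hG : CnOn F (n + 1) G U)
    (hU : IsOpen U) {γ : ℝ → E} {γ' : E} {t : ℝ} (hγ : HasDerivAt γ γ' t) (ht : γ t ∈ U) :
    HasDerivAt (fun s => G (γ s)) (D G (γ t) γ') t := by
  rw [hasDerivAt_iff_tendsto_inv_smul] at *
  have hs : Tendsto (fun s : ℝ => s) (𝓝[≠] 0) (𝓝 0) := tendsto_nhds_of_tendsto_nhdsWithin
    tendsto_id
  -- The base point is fixed and the moving direction is the difference quotient of `γ`, so that `γ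
  -- (t + s)` is exactly the base point plus `s` times that direction.
  refine (hG.tendsto_slope hU ht (tendsto_const_nhds (x := γ t)) hγ hs
    self_mem_nhdsWithin).congr' ?_
  filter_upwards [self_mem_nhdsWithin] with s hs
  rw [smul_inv_smul₀ hs, add_sub_cancel]

variable [T2Space F]

theorem CnOn.D_smul (hG : CnOn F (n + 1) G U) (hx : x ∈ U) (c : ℝ) (h : E) :
    D G x (c • h) = c • D G x h := by
  refine D_eq_of_hasDerivAt ?_
  have h1 := hasDerivAt_D (hG.2.1 x hx h)
  have h2 : HasDerivAt (fun s : ℝ => s * c) c 0 := by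
    simpa using (hasDerivAt_id (0 : ℝ)).mul_const c
  have h3 := HasDerivAt.tvs_scomp (x := 0) (c := fun s => s * c) (by simpa using h1) h2
  simpa [mul_smul] using h3

/-- The increment along `h + k` is an increment along `h` from `x` followed by one along `k` from
the displaced point `x + s • h`; the displacement is why moving base points are needed. -/
theorem CnOn.D_add [LocallyConvexSpace ℝ F] (hG : CnOn F (n + 1) G U) (hU : IsOpen U)
    (hx : x ∈ U) (h k : E) : D G x (h + k) = D G x h + D G x k := by
  have hs : Tendsto (fun s : ℝ => s) (𝓝[≠] 0) (𝓝 0) := tendsto_nhds_of_tendsto_nhdsWithin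
    tendsto_id
  have hy : Tendsto (fun s : ℝ => x + s • h) (𝓝[≠] 0) (𝓝 x) := by
    have : ContinuousAt (fun s : ℝ => x + s • h) 0 := by fun_prop
    simpa using this.tendsto.mono_left nhdsWithin_le_nhds
  have h1 := hG.tendsto_slope hU hx hy (tendsto_const_nhds (x := k)) hs self_mem_nhdsWithin
  have h2 := hG.tendsto_slope hU hx (tendsto_const_nhds (x := x)) (tendsto_const_nhds (x := h)) hs
    self_mem_nhdsWithin
  have h3 := hG.tendsto_slope hU hx (tendsto_const_nhds (x := x))
    (tendsto_const_nhds (x := h + k)) hs self_mem_nhdsWithin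
  refine tendsto_nhds_unique h3 ((h2.add h1).congr fun s => ?_)
  rw [← smul_add, smul_add s h k, ← add_assoc]
  congr 1
  abel

/-- The derivative of a `C¹` map as a continuous linear map. -/
theorem CnOn.exists_clm [LocallyConvexSpace ℝ F] (hG : CnOn F (n + 1) G U) (hU : IsOpen U)
    (hx : x ∈ U) : ∃ L : E →L[ℝ] F, ∀ h, L h = D G x h := by
  refine ⟨⟨⟨⟨D G x, hG.D_add hU hx⟩, hG.D_smul hx⟩, ?_⟩, fun h => rfl⟩
  have h1 : ContinuousOn (fun h : E => D G x h) univ :=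
    hG.2.2.continuousOn.comp (f := fun h : E => (x, h)) (by fun_prop) fun h _ => ⟨hx, mem_univ _⟩
  exact continuousOn_univ.1 h1

theorem CnOn.D_sub [LocallyConvexSpace ℝ F] (hG : CnOn F (n + 1) G U) (hU : IsOpen U)
    (hx : x ∈ U) (h k : E) : D G x (h - k) = D G x h - D G x k := by
  obtain ⟨L, hL⟩ := hG.exists_clm hU hx
  simp only [← hL, map_sub]

theorem CnOn.D_zero [LocallyConvexSpace ℝ F] (hG : CnOn F (n + 1) G U) (hU : IsOpen U)
    (hx : x ∈ U) : D G x 0 = 0 := by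
  obtain ⟨L, hL⟩ := hG.exists_clm hU hx
  simp only [← hL, map_zero]

end Calculus

/-! ### Stability of `Cⁿ` under operations; second derivatives. -/

section Calculus

variable {E : Type*} [AddCommGroup E] [Module ℝ E] [TopologicalSpace E]
  [IsTopologicalAddGroup E] [ContinuousSMul ℝ E]
variable {E' : Type*} [AddCommGroup E'] [Module ℝ E'] [TopologicalSpace E']
  [IsTopologicalAddGroup E'] [ContinuousSMul ℝ E']
variable {F : Type*} [AddCommGroup F] [Module ℝ F] [TopologicalSpace F]
  [IsTopologicalAddGroup F] [ContinuousSMul ℝ F] [T2Space F]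
variable {F' : Type*} [AddCommGroup F'] [Module ℝ F'] [TopologicalSpace F']
  [IsTopologicalAddGroup F'] [ContinuousSMul ℝ F'] [T2Space F']
variable {G H : E → F} {U W : Set E} {n : ℕ} {x h k : E}

theorem eventually_add_smul_mem (hU : IsOpen U) (hx : x ∈ U) (h : E) :
    ∀ᶠ s : ℝ in 𝓝 0, x + s • h ∈ U := by
  have : ContinuousAt (fun s : ℝ => x + s • h) 0 := by fun_prop
  exact this.eventually (hU.mem_nhds (by simpa using hx))

theorem D_congr (hU : IsOpen U) (hGH : EqOn G H U) (hx : x ∈ U)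
    (hG : DifferentiableAt ℝ (fun s : ℝ => G (x + s • h)) 0) :
    HasDerivAt (fun s : ℝ => H (x + s • h)) (D G x h) 0 :=
  (hasDerivAt_D hG).tvs_congr ((eventually_add_smul_mem hU hx h).mono fun _ hs => (hGH hs).symm)

theorem CnOn.congr (hG : CnOn F n G U) (hU : IsOpen U) (hGH : EqOn G H U) : CnOn F n H U := by
  induction n generalizing E with
  | zero => exact ContinuousOn.congr hG hGH.symm
  | succ n ih =>
    have key := fun x hx h => D_congr hU hGH hx (hG.2.1 x hx h)
    refine ⟨hG.1.congr hGH.symm, fun x hx h => HasFDerivAt.differentiableAt (key x hx h),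
      ih hG.2.2 (hU.prod isOpen_univ) ?_⟩
    rintro ⟨x, h⟩ ⟨hx, -⟩
    exact (D_eq_of_hasDerivAt (key x hx h)).symm

/-- The identity `D (G ∘ L) = D G ∘ (L × L)` holds without any smoothness. The case of a projection
feeds the induction in `CnOn.comp`. -/
theorem CnOn.comp_clm {G : E' → F} {U : Set E'} (hG : CnOn F n G U) (L : E →L[ℝ] E') :
    CnOn F n (fun x => G (L x)) (L ⁻¹' U) := by
  induction n generalizing E E' with
  | zero => exact ContinuousOn.comp hG L.continuous.continuousOn fun x hx => hx
  | succ n ih =>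
    refine ⟨hG.1.comp L.continuous.continuousOn fun x hx => hx,
      fun x hx h => by simpa using hG.2.1 (L x) hx (L h), ?_⟩
    have h1 := ih hG.2.2 (L.prodMap L)
    have h2 : (fun p : E × E => D (fun x => G (L x)) p.1 p.2)
        = fun p : E × E => D G (L p.1) (L p.2) := by
      ext p; simp [D]
    rw [h2]
    exact h1.mono fun p hp => ⟨hp.1, mem_univ _⟩

theorem CnOn.clm_comp (hG : CnOn F n G U) (hU : IsOpen U) (L : F →L[ℝ] F') :
    CnOn F' n (fun x => L (G x)) U := by
  induction n generalizing E with
  | zero => exact L.continuous.comp_continuousOn hG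
  | succ n ih =>
    have key := fun x hx h => (hasDerivAt_D (hG.2.1 x hx h)).tvs_comp_clm L
    refine ⟨L.continuous.comp_continuousOn hG.1,
      fun x hx h => HasFDerivAt.differentiableAt (key x hx h),
      (ih hG.2.2 (hU.prod isOpen_univ)).congr (hU.prod isOpen_univ) ?_⟩
    rintro ⟨x, h⟩ ⟨hx, -⟩
    exact (D_eq_of_hasDerivAt (key x hx h)).symm

theorem CnOn.prodMk {H : E → F'} (hG : CnOn F n G U) (hH : CnOn F' n H U) (hU : IsOpen U) :
    CnOn (F × F') n (fun x => (G x, H x)) U := by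
  induction n generalizing E with
  | zero => exact ContinuousOn.prodMk hG hH
  | succ n ih =>
    have key := fun x hx h =>
      (hasDerivAt_D (hG.2.1 x hx h)).tvs_prodMk (hasDerivAt_D (hH.2.1 x hx h))
    refine ⟨hG.1.prodMk hH.1,
      fun x hx h => HasFDerivAt.differentiableAt (key x hx h),
      (ih hG.2.2 hH.2.2 (hU.prod isOpen_univ)).congr (hU.prod isOpen_univ) ?_⟩
    rintro ⟨x, h⟩ ⟨hx, -⟩
    exact (D_eq_of_hasDerivAt (key x hx h)).symm

theorem cnOn_const (c : F) (U : Set E) : CnOn F n (fun _ : E => c) U := by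
  induction n generalizing E c with
  | zero => exact continuousOn_const
  | succ n ih =>
    have key := fun x h : E => (hasDerivAt_const_tvs c (0 : ℝ))
    refine ⟨continuousOn_const, fun x hx h => HasFDerivAt.differentiableAt (key x h), ?_⟩
    have : (fun p : E × E => D (fun _ : E => c) p.1 p.2) = fun _ => (0 : F) := by
      ext p
      exact D_eq_of_hasDerivAt (key p.1 p.2)
    rw [this]
    exact ih 0 _

theorem hasDerivAt_clm (L : E →L[ℝ] F) (x h : E) (r : ℝ) :
    HasDerivAt (fun s : ℝ => L (x + s • h)) (L h) r :=
  (hasDerivAt_add_smul x h r).tvs_comp_clm L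

theorem D_clm (L : E →L[ℝ] F) (x h : E) : D L x h = L h :=
  D_eq_of_hasDerivAt (hasDerivAt_clm L x h 0)

theorem cnOn_clm (L : E →L[ℝ] F) (U : Set E) : CnOn F n (fun x => L x) U := by
  induction n generalizing E with
  | zero => exact L.continuous.continuousOn
  | succ n ih =>
    refine ⟨L.continuous.continuousOn,
      fun x hx h => HasFDerivAt.differentiableAt (hasDerivAt_clm L x h 0), ?_⟩
    have : (fun p : E × E => D L p.1 p.2) =
        fun p => (L.comp (ContinuousLinearMap.snd ℝ E E)) p := by
      ext p
      exact D_clm L _ _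
    rw [this]
    exact ih _ _

/-- The derivative of the composite is `D G` composed with `(x, h) ↦ (H x, D H x h)`, which is again
a composite, with one order of smoothness less. -/
theorem CnOn.comp [LocallyConvexSpace ℝ F] [T2Space E'] {G : E' → F} {U : Set E'} {H : E → E'}
    (hG : CnOn F n G U) (hH : CnOn E' n H W) (hU : IsOpen U) (hW : IsOpen W)
    (hm : MapsTo H W U) : CnOn F n (fun x => G (H x)) W := by
  induction n generalizing E E' with
  | zero => exact ContinuousOn.comp hG hH hm
  | succ n ih =>
    have key := fun x hx h => hG.hasDerivAt_comp hU (hasDerivAt_D (hH.2.1 x hx h))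
      (by simpa using hm hx)
    refine ⟨hG.1.comp hH.1 hm, fun x hx h => HasFDerivAt.differentiableAt (key x hx h), ?_⟩
    have hWo : IsOpen (W ×ˢ (univ : Set E)) := hW.prod isOpen_univ
    have h1 : CnOn (E' × E') n (fun p : E × E => (H p.1, D H p.1 p.2)) (W ×ˢ univ) :=
      (((hH.of_succ).comp_clm (ContinuousLinearMap.fst ℝ E E)).mono fun p hp => hp.1).prodMk
        hH.2.2 hWo
    refine (ih hG.2.2 h1 (hU.prod isOpen_univ) hWo
      fun p hp => ⟨hm hp.1, mem_univ _⟩).congr hWo ?_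
    rintro ⟨x, h⟩ ⟨hx, -⟩
    have := D_eq_of_hasDerivAt (G := fun x => G (H x)) (key x hx h)
    simpa using this.symm

theorem CnOn.add (hG : CnOn F n G U) (hH : CnOn F n H U) (hU : IsOpen U) :
    CnOn F n (fun x => G x + H x) U :=
  (hG.prodMk hH hU).clm_comp hU (ContinuousLinearMap.fst ℝ F F + ContinuousLinearMap.snd ℝ F F)

theorem CnOn.sub (hG : CnOn F n G U) (hH : CnOn F n H U) (hU : IsOpen U) :
    CnOn F n (fun x => G x - H x) U :=
  (hG.prodMk hH hU).clm_comp hU (ContinuousLinearMap.fst ℝ F F - ContinuousLinearMap.snd ℝ F F)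

theorem CnOn.neg (hG : CnOn F n G U) (hU : IsOpen U) : CnOn F n (fun x => -G x) U :=
  hG.clm_comp hU (-ContinuousLinearMap.id ℝ F)

theorem CnOn.const_smul (hG : CnOn F n G U) (hU : IsOpen U) (c : ℝ) :
    CnOn F n (fun x => c • G x) U :=
  hG.clm_comp hU (c • ContinuousLinearMap.id ℝ F)

theorem CnOn.D_comp [LocallyConvexSpace ℝ F] [T2Space E'] {G : E' → F} {U : Set E'}
    {b d : E → E'} (hG : CnOn F (n + 1) G U) (hb : CnOn E' n b W) (hd : CnOn E' n d W)
    (hU : IsOpen U) (hW : IsOpen W) (hm : MapsTo b W U) :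
    CnOn F n (fun z => D G (b z) (d z)) W :=
  hG.2.2.comp (hb.prodMk hd hW) (hU.prod isOpen_univ) hW fun _ hz => ⟨hm hz, mem_univ _⟩

/-- This turns statements about second derivatives into statements about first derivatives of the
map `(x, h) ↦ D G x h`. -/
theorem D2_eq (G : E → F) (x h k : E) :
    D2 G x h k = D (fun p : E × E => D G p.1 p.2) (x, h) (k, 0) := by
  simp [D2, D]

theorem CnOn.D2_comp [LocallyConvexSpace ℝ F] [T2Space E'] {G : E' → F} {U : Set E'}
    {b d e : E → E'} (hG : CnOn F (n + 2) G U) (hb : CnOn E' n b W) (hd : CnOn E' n d W)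
    (he : CnOn E' n e W) (hU : IsOpen U) (hW : IsOpen W) (hm : MapsTo b W U) :
    CnOn F n (fun z => D2 G (b z) (d z) (e z)) W := by
  simp only [D2_eq]
  exact hG.2.2.D_comp (hb.prodMk hd hW) (he.prodMk (cnOn_const 0 W) hW) (hU.prod isOpen_univ) hW
    fun _ hz => ⟨hm hz, mem_univ _⟩

theorem CnOn.D_apply [LocallyConvexSpace ℝ F] [T2Space E] (hG : CnOn F (n + 1) G U)
    (hU : IsOpen U) (h : E) : CnOn F n (fun x => D G x h) U :=
  hG.D_comp (cnOn_clm (ContinuousLinearMap.id ℝ E) U) (cnOn_const h U) hU hU fun _ hx => hx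

/-- Symmetry of second derivatives. -/
theorem CnOn.D2_symm [LocallyConvexSpace ℝ F] [T2Space E] (hG : CnOn F (n + 2) G U)
    (hU : IsOpen U) (hx : x ∈ U) (h k : E) : D2 G x h k = D2 G x k h := by
  -- The second difference quotient converges to `D2 G x h k`, and it is symmetric in `h` and `k`.
  have key : ∀ h k : E, Tendsto (fun s : ℝ => s⁻¹ • s⁻¹ •
      (G (x + s • h + s • k) - G (x + s • h) - (G (x + s • k) - G x))) (𝓝[≠] 0)
      (𝓝 (D2 G x h k)) := by
    intro h k N hN
    obtain ⟨C, hC, hC1, hC2, hCN⟩ := exists_isClosed_convex_mem_nhds hN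
    -- The principal filter in the second variable makes the convergence uniform over the position
    -- `r ∈ [0,1]` on the segment in direction `h`.
    let l : Filter (ℝ × ℝ) := 𝓝[≠] 0 ×ˢ 𝓟 (Icc 0 1)
    have hs : Tendsto (fun a : ℝ × ℝ => a.1) l (𝓝 0) :=
      tendsto_fst.mono_right nhdsWithin_le_nhds
    have hs0 : ∀ᶠ a : ℝ × ℝ in l, a.1 ≠ 0 := tendsto_fst.eventually self_mem_nhdsWithin
    have hρ : ∀ᶠ a : ℝ × ℝ in l, a.2 ∈ Icc (0 : ℝ) 1 :=
      tendsto_snd.eventually (mem_principal_self _)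
    have hρs : Tendsto (fun a : ℝ × ℝ => a.2 * a.1) l (𝓝 0) := by
      refine squeeze_zero_norm' (hρ.mono fun a ha => ?_) (by simpa using hs.norm)
      rw [norm_mul, Real.norm_of_nonneg ha.1]
      exact mul_le_of_le_one_left (norm_nonneg _) ha.2
    have hy : Tendsto (fun a : ℝ × ℝ => x + (a.2 * a.1) • h) l (𝓝 x) := by
      simpa using tendsto_const_nhds.add (hρs.smul_const h)
    have hy' : Tendsto (fun a : ℝ × ℝ => x + (a.2 * a.1) • h + a.1 • k) l (𝓝 x) := by
      simpa using hy.add (hs.smul_const k)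
    have h1 := (hG.D_apply hU h).tendsto_slope hU hx hy (tendsto_const_nhds (x := k)) hs hs0
    have h2 := ((h1.eventually hC).and ((hy.eventually (hU.mem_nhds hx)).and
      (hy'.eventually (hU.mem_nhds hx))))
    rw [eventually_prod_principal_iff] at h2
    rw [mem_map]
    refine mem_of_superset ?_ (preimage_mono hCN)
    filter_upwards [h2, self_mem_nhdsWithin] with s h3 hs0
    replace hs0 : s ≠ 0 := hs0
    have h4 := sub_mem_of_hasDerivAt (f := fun r : ℝ => s⁻¹ • s⁻¹ •
      (G (x + (r * s) • h + s • k) - G (x + (r * s) • h))) hC2 hC1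
      (f' := fun r => s⁻¹ • (D G (x + (r * s) • h + s • k) h - D G (x + (r * s) • h) h))
      (fun r hr => ?_) (fun r hr => (h3 r hr).1)
    · simpa [smul_sub] using h4
    · have hc : HasDerivAt (fun r : ℝ => r * s) s r := by
        simpa using (hasDerivAt_id r).mul_const s
      have h5 := (hG.hasDerivAt_line (h3 r hr).2.1).tvs_scomp (x := r) (c := fun r => r * s) hc
      have h6 : HasDerivAt (fun r : ℝ => G (x + r • h + s • k))
          (D G (x + (r * s) • h + s • k) h) (r * s) := by
        have : x + s • k + (r * s) • h ∈ U := by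
          rw [add_right_comm]
          exact (h3 r hr).2.2
        simpa [add_right_comm] using hG.hasDerivAt_line this
      have h7 := h6.tvs_scomp (x := r) (c := fun r => r * s) hc
      have h8 := ((h7.tvs_sub h5).tvs_const_smul s⁻¹).tvs_const_smul s⁻¹
      rw [← smul_sub, inv_smul_smul₀ hs0] at h8
      exact h8
  refine tendsto_nhds_unique (key h k) ((key k h).congr fun s => ?_)
  rw [add_right_comm]
  congr 2
  abel

variable [LocallyConvexSpace ℝ F] [T2Space E]

theorem CnOn.exists_clm_D2 (hG : CnOn F (n + 2) G U) (hU : IsOpen U) (hx : x ∈ U) (h : E) :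
    ∃ L : E →L[ℝ] F, ∀ k, L k = D2 G x h k :=
  (hG.D_apply hU h).exists_clm hU hx

/-- Product rule for `r ↦ G'(x(r)) h(r)`. -/
theorem CnOn.hasDerivAt_D_comp (hG : CnOn F (n + 2) G U) (hU : IsOpen U) {b d : ℝ → E}
    {b' d' : E} {t : ℝ} (hb : HasDerivAt b b' t) (hd : HasDerivAt d d' t) (ht : b t ∈ U) :
    HasDerivAt (fun s => D G (b s) (d s)) (D2 G (b t) (d t) b' + D G (b t) d') t := by
  have hU' : IsOpen (U ×ˢ (univ : Set E)) := hU.prod isOpen_univ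
  have hm : (b t, d t) ∈ U ×ˢ (univ : Set E) := ⟨ht, mem_univ _⟩
  have h1 := hG.2.2.hasDerivAt_comp hU' (hb.tvs_prodMk hd) hm
  have h2 : D (fun p : E × E => D G p.1 p.2) (b t, d t) (b', d') =
      D2 G (b t) (d t) b' + D G (b t) d' := by
    have : (b', d') = (b', (0 : E)) + (0, d') := by simp
    rw [this, hG.2.2.D_add hU' hm, D2_eq]
    congr 1
    refine D_eq_of_hasDerivAt ?_
    obtain ⟨L, hL⟩ := hG.exists_clm hU ht
    simpa [← hL] using hasDerivAt_clm L (d t) d' 0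
  rwa [h2] at h1

end Calculus

/-! ### Weak integrals: estimates, and existence in complete spaces. -/

section Integrals

variable {V : Type*} [AddCommGroup V] [Module ℝ V]

section TVS

variable [TopologicalSpace V] [IsTopologicalAddGroup V] [ContinuousSMul ℝ V]
variable {f g : ℝ → V} {a b : ℝ} {I J : V}

/-- Hahn-Banach: a continuous seminorm is attained by a continuous linear functional below it. -/
theorem exists_clm_eq_seminorm (p : Seminorm ℝ V) (hp : Continuous p) (x : V) :
    ∃ φ : V →L[ℝ] ℝ, (∀ y, |φ y| ≤ p y) ∧ φ x = p x := by
  rcases eq_or_ne x 0 with rfl | hx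
  · exact ⟨0, fun y => by simp, by simp⟩
  obtain ⟨g, hg1, hg2⟩ := exists_extension_of_le_sublinear
    (LinearPMap.mkSpanSingleton x (p x) hx) p
    (fun c hc y => by rw [map_smul_eq_mul, Real.norm_of_nonneg hc.le]) (map_add_le_add p) (by
      rintro ⟨y, hy⟩
      obtain ⟨c, rfl⟩ := Submodule.mem_span_singleton.1 hy
      refine (LinearPMap.mkSpanSingleton'_apply _ _ _ _ _).trans_le ?_
      rw [map_smul_eq_mul]
      exact mul_le_mul_of_nonneg_right (le_abs_self c) (apply_nonneg p x))
  have hg3 : ∀ y, |g y| ≤ p y := fun y => abs_le.2 ⟨by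
    have := hg2 (-y)
    rw [map_neg, map_neg_eq_map] at this
    linarith, hg2 y⟩
  refine ⟨⟨g, ?_⟩, hg3, ?_⟩
  · refine continuous_of_continuousAt_zero g.toAddMonoidHom ?_
    have h0 : Tendsto p (𝓝 0) (𝓝 0) := by simpa using hp.tendsto 0
    have := squeeze_zero_norm (f := fun y => g y) hg3 h0
    simpa [ContinuousAt] using this
  · have := hg1 ⟨x, Submodule.mem_span_singleton_self x⟩
    rwa [LinearPMap.mkSpanSingleton_apply] at this

theorem IsIntegral.add (hf : IsIntegral f a b I) (hg : IsIntegral g a b J) :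
    IsIntegral (fun τ => f τ + g τ) a b (I + J) := by
  intro φ
  simp only [map_add]
  refine ⟨(hf φ).1.add (hg φ).1, ?_⟩
  rw [intervalIntegral.integral_add (hf φ).1 (hg φ).1, (hf φ).2, (hg φ).2]

theorem IsIntegral.clm {W : Type*} [AddCommGroup W] [Module ℝ W] [TopologicalSpace W]
    (hf : IsIntegral f a b I) (L : V →L[ℝ] W) : IsIntegral (fun τ => L (f τ)) a b (L I) :=
  fun φ => hf (φ.comp L)

theorem IsIntegral.neg (hf : IsIntegral f a b I) : IsIntegral (fun τ => -f τ) a b (-I) :=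
  hf.clm (-ContinuousLinearMap.id ℝ V)

theorem IsIntegral.sub (hf : IsIntegral f a b I) (hg : IsIntegral g a b J) :
    IsIntegral (fun τ => f τ - g τ) a b (I - J) := by
  simpa only [sub_eq_add_neg] using hf.add hg.neg

theorem IsIntegral.congr (hf : IsIntegral f a b I) (hab : a ≤ b) (hfg : EqOn f g (Icc a b)) :
    IsIntegral g a b I := by
  intro φ
  have h : EqOn (fun τ => φ (f τ)) (fun τ => φ (g τ)) (uIcc a b) := fun τ hτ => by
    rw [uIcc_of_le hab] at hτ
    simp only [hfg hτ]
  refine ⟨(hf φ).1.congr_ae ?_, by rw [← (hf φ).2, intervalIntegral.integral_congr h]⟩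
  exact (ae_restrict_iff' measurableSet_uIoc).2 (ae_of_all _ fun τ hτ => h (uIoc_subset_uIcc hτ))

theorem IsIntegral.interval_sub {c : ℝ} (hf : IsIntegral f a b I) (hg : IsIntegral f a c J) :
    IsIntegral f b c (J - I) := by
  intro φ
  refine ⟨(hf φ).1.symm.trans (hg φ).1, ?_⟩
  rw [map_sub, ← (hf φ).2, ← (hg φ).2,
    intervalIntegral.integral_interval_sub_left (hg φ).1 (hf φ).1]

theorem IsIntegral.of_hasDerivAt {f' : ℝ → V} (hab : a ≤ b)
    (hf : ∀ τ ∈ Icc a b, HasDerivAt f (f' τ) τ) (hc : ContinuousOn f' (Icc a b)) :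
    IsIntegral f' a b (f b - f a) := by
  intro φ
  have hi : IntervalIntegrable (fun τ => φ (f' τ)) volume a b := by
    refine ContinuousOn.intervalIntegrable ?_
    rw [uIcc_of_le hab]
    exact φ.continuous.comp_continuousOn hc
  refine ⟨hi, ?_⟩
  rw [map_sub]
  refine intervalIntegral.integral_eq_sub_of_hasDerivAt (f := fun τ => φ (f τ)) (fun τ hτ => ?_) hi
  rw [uIcc_of_le hab] at hτ
  exact (hf τ hτ).tvs_comp_clm φ

/-- The velocity is `D f τ 1`, whose continuity is part of the definition of `C¹`; it need not be
read off an explicit formula for `f'`. -/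
theorem CnOn.continuousOn_deriv [T2Space V] {U : Set ℝ} (hf : CnOn V 1 f U) {f' : ℝ → V}
    {K : Set ℝ} (hK : K ⊆ U) (hd : ∀ τ ∈ K, HasDerivAt f (f' τ) τ) : ContinuousOn f' K := by
  have h1 : ContinuousOn (fun τ => D f τ 1) K :=
    ContinuousOn.comp (f := fun τ : ℝ => (τ, (1 : ℝ))) hf.2.2 (by fun_prop)
      fun τ hτ => ⟨hK hτ, mem_univ _⟩
  refine h1.congr fun τ hτ => (D_eq_of_hasDerivAt ?_).symm
  have h2 : HasDerivAt (fun s : ℝ => τ + s • (1 : ℝ)) 1 0 := hasDerivAt_add_smul τ 1 0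
  simpa using HasDerivAt.tvs_scomp (f := f) (c := fun s : ℝ => τ + s • (1 : ℝ)) (x := 0)
    (by simpa using hd τ hτ) h2

theorem IsIntegral.of_cnOn [T2Space V] {U : Set ℝ} (hab : a ≤ b) (hf : CnOn V 1 f U)
    (hU : Icc a b ⊆ U) {f' : ℝ → V} (hd : ∀ τ ∈ Icc a b, HasDerivAt f (f' τ) τ) :
    IsIntegral f' a b (f b - f a) :=
  .of_hasDerivAt hab hd (hf.continuousOn_deriv hU hd)

/-- A functional dominated by `p` and attaining `p I` reduces the bound to a scalar integral. -/
theorem IsIntegral.seminorm_le (hf : IsIntegral f a b I) (hab : a ≤ b) {p : Seminorm ℝ V}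
    (hp : Continuous p) {c : ℝ} (hc : ∀ τ ∈ Icc a b, p (f τ) ≤ c) : p I ≤ c * (b - a) := by
  obtain ⟨φ, h1, h2⟩ := exists_clm_eq_seminorm p hp I
  rw [← h2, ← (hf φ).2]
  have := intervalIntegral.integral_mono_on hab (hf φ).1 (intervalIntegrable_const (c := c))
    fun τ hτ => (le_abs_self _).trans ((h1 _).trans (hc τ hτ))
  simpa [mul_comm] using this

theorem IsDoubleIntegral.seminorm_le {t : ℝ} (hf : IsDoubleIntegral f t I) (ht : 0 ≤ t)
    {p : Seminorm ℝ V} (hp : Continuous p) {c : ℝ} (hc : ∀ τ ∈ Icc 0 t, p (f τ) ≤ c) :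
    p I ≤ c * t * t := by
  obtain ⟨g, hg, hI⟩ := hf
  have hc0 : 0 ≤ c := (apply_nonneg p _).trans (hc 0 ⟨le_rfl, ht⟩)
  have h1 : ∀ τ ∈ Icc 0 t, p (g τ) ≤ c * t := fun τ hτ => by
    have := (hg τ hτ).seminorm_le hτ.1 hp fun σ hσ => hc σ ⟨hσ.1, hσ.2.trans hτ.2⟩
    rw [sub_zero] at this
    exact this.trans (mul_le_mul_of_nonneg_left hτ.2 hc0)
  simpa using hI.seminorm_le ht hp h1

theorem IsDoubleIntegral.sub {t : ℝ} (hf : IsDoubleIntegral f t I) (hg : IsDoubleIntegral g t J) :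
    IsDoubleIntegral (fun τ => f τ - g τ) t (I - J) := by
  obtain ⟨F, hF, hI⟩ := hf
  obtain ⟨G, hG, hJ⟩ := hg
  exact ⟨fun τ => F τ - G τ, fun τ hτ => (hF τ hτ).sub (hG τ hτ), hI.sub hJ⟩

theorem IsDoubleIntegral.congr {t : ℝ} (hf : IsDoubleIntegral f t I)
    (hfg : EqOn f g (Icc 0 t)) : IsDoubleIntegral g t I := by
  obtain ⟨F, hF, hI⟩ := hf
  exact ⟨F, fun τ hτ => (hF τ hτ).congr hτ.1 fun σ hσ => hfg ⟨hσ.1, hσ.2.trans hτ.2⟩, hI⟩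

theorem isIntegral_const (c : V) (a b : ℝ) : IsIntegral (fun _ => c) a b ((b - a) • c) :=
  fun φ => ⟨intervalIntegrable_const, by simp⟩

/-- The source of the factor `t³/6` in the leading term. -/
theorem isDoubleIntegral_smul (c : V) (t : ℝ) :
    IsDoubleIntegral (fun τ => τ • c) t ((t ^ 3 / 6) • c) := by
  refine ⟨fun τ => (τ ^ 2 / 2) • c, fun τ _ φ => ⟨?_, ?_⟩, fun φ => ⟨?_, ?_⟩⟩
  · exact Continuous.intervalIntegrable (by simp only [map_smul]; fun_prop) _ _
  · simp [intervalIntegral.integral_mul_const]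
  · exact Continuous.intervalIntegrable (by simp only [map_smul]; fun_prop) _ _
  · simp [intervalIntegral.integral_mul_const, intervalIntegral.integral_div]
    exact Or.inl (by ring)

/-- Error of the left Riemann sum with `n` nodes of a real function. -/
theorem abs_riemann_sub_integral_le {g : ℝ → ℝ} (hab : a ≤ b) (hg : ContinuousOn g (Icc a b))
    {n : ℕ} (hn : 0 < n) {η : ℝ}
    (hη : ∀ x ∈ Icc a b, ∀ y ∈ Icc a b, |x - y| ≤ (b - a) / n → |g x - g y| ≤ η) :
    |(b - a) / n * ∑ k ∈ Finset.range n, g (a + k * ((b - a) / n)) - ∫ τ in a..b, g τ|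
      ≤ η * (b - a) := by
  set δ := (b - a) / n with hδ
  have hn' : (0 : ℝ) < n := Nat.cast_pos.2 hn
  have hδ0 : 0 ≤ δ := div_nonneg (sub_nonneg.2 hab) hn'.le
  have hnδ : n * δ = b - a := by rw [hδ]; field_simp
  set x : ℕ → ℝ := fun k => a + k * δ with hx
  have hxs : ∀ k, x (k + 1) = x k + δ := fun k => by simp only [hx]; push_cast; ring
  have hmem : ∀ k < n, Icc (x k) (x (k + 1)) ⊆ Icc a b := by
    intro k hk
    have hk1 : ((k : ℝ) + 1) ≤ n := by exact_mod_cast hk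
    refine Icc_subset_Icc ?_ ?_
    · simp only [hx]; nlinarith [Nat.cast_nonneg (α := ℝ) k]
    · simp only [hx]; push_cast; nlinarith
  have hi : ∀ k < n, IntervalIntegrable g volume (x k) (x (k + 1)) := fun k hk => by
    refine ContinuousOn.intervalIntegrable ?_
    rw [uIcc_of_le (by rw [hxs]; linarith)]
    exact hg.mono (hmem k hk)
  have hsum := intervalIntegral.sum_integral_adjacent_intervals hi
  have hx0 : x 0 = a := by simp [hx]
  have hxn : x n = b := by simp only [hx]; linarith
  rw [hx0, hxn] at hsum
  rw [← hsum, Finset.mul_sum, ← Finset.sum_sub_distrib]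
  refine (Finset.abs_sum_le_sum_abs _ _).trans ?_
  have hk : ∀ k ∈ Finset.range n, |δ * g (x k) - ∫ τ in x k..x (k + 1), g τ| ≤ η * δ := by
    intro k hk
    rw [Finset.mem_range] at hk
    have h1 : δ * g (x k) = ∫ τ in x k..x (k + 1), g (x k) := by
      rw [intervalIntegral.integral_const, hxs, add_sub_cancel_left, smul_eq_mul]
    rw [h1, ← intervalIntegral.integral_sub intervalIntegrable_const (hi k hk)]
    have h2 := intervalIntegral.norm_integral_le_of_norm_le_const (a := x k) (b := x (k + 1))
      (f := fun τ => g (x k) - g τ) (C := η) (fun τ hτ => ?_)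
    · rwa [hxs, add_sub_cancel_left, abs_of_nonneg hδ0, ← hxs] at h2
    · have hle : x k ≤ x (k + 1) := by rw [hxs]; linarith
      rw [uIoc_of_le hle] at hτ
      refine hη _ (hmem k hk ⟨le_rfl, hle⟩) _ (hmem k hk (Ioc_subset_Icc_self hτ)) ?_
      rw [abs_sub_comm, abs_of_nonneg (by linarith [hτ.1])]
      linarith [hτ.2, hxs k]
  refine (Finset.sum_le_sum hk).trans ?_
  rw [Finset.sum_const, Finset.card_range, nsmul_eq_mul, ← hnδ]
  apply le_of_eq; ring

end TVS

section Complete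

variable [UniformSpace V] [IsUniformAddGroup V] [ContinuousSMul ℝ V] [LocallyConvexSpace ℝ V]
variable {f : ℝ → V} {a b : ℝ}

/-- Continuous curves in complete locally convex spaces have integrals. -/
theorem exists_isIntegral [CompleteSpace V] (hab : a ≤ b) (hf : ContinuousOn f (Icc a b)) :
    ∃ I, IsIntegral f a b I := by
  have hlim : Tendsto (fun n : ℕ => (b - a) / n) atTop (𝓝 0) :=
    tendsto_const_div_atTop_nhds_zero_nat _
  have hfu := isCompact_Icc.uniformContinuousOn_of_continuous hf
  have hosc : ∀ p : Seminorm ℝ V, Continuous p → ∀ η > 0, ∀ᶠ n : ℕ in atTop,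
      ∀ x ∈ Icc a b, ∀ y ∈ Icc a b, |x - y| ≤ (b - a) / n → p (f x - f y) ≤ η := by
    intro p hp η hη
    have hP : {q : V × V | p (q.1 - q.2) < η} ∈ uniformity V := by
      rw [uniformity_eq_comap_nhds_zero_swapped]
      refine ⟨{x | p x < η}, (isOpen_lt hp continuous_const).mem_nhds (by simpa using hη), ?_⟩
      intro q hq
      exact hq
    have h1 := hfu hP
    rw [mem_map, mem_inf_principal] at h1
    obtain ⟨ε, hε, h2⟩ := Metric.mem_uniformity_dist.1 h1
    filter_upwards [hlim.eventually (gt_mem_nhds hε)] with n hn x hx y hy hxy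
    exact (h2 (a := x) (b := y) (hxy.trans_lt hn) ⟨hx, hy⟩).le
  let R : ℕ → V := fun n => ((b - a) / n) • ∑ k ∈ Finset.range n, f (a + k * ((b - a) / n))
  have hR : ∀ φ : V →L[ℝ] ℝ, ∀ n, φ (R n) =
      (b - a) / n * ∑ k ∈ Finset.range n, φ (f (a + k * ((b - a) / n))) := fun φ n => by
    simp [R]
  have hba : 0 ≤ b - a := sub_nonneg.2 hab
  -- The Riemann sum error is uniform over all functionals dominated by `p`. This uniformity lets
  -- Hahn–Banach convert it into the Cauchy property with respect to `p`.
  have herr : ∀ p : Seminorm ℝ V, Continuous p → ∀ η > 0, ∀ᶠ n : ℕ in atTop,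
      ∀ φ : V →L[ℝ] ℝ, (∀ y, |φ y| ≤ p y) → |φ (R n) - ∫ τ in a..b, φ (f τ)| ≤ η * (b - a) := by
    intro p hp η hη
    filter_upwards [hosc p hp η hη, eventually_gt_atTop 0] with n hn hn0 φ hφ
    rw [hR]
    refine abs_riemann_sub_integral_le hab (φ.continuous.comp_continuousOn hf) hn0
      fun x hx y hy hxy => ?_
    rw [Function.comp_apply, Function.comp_apply, ← map_sub]
    exact (hφ _).trans (hn x hx y hy hxy)
  have hcauchy : CauchySeq R := by
    rw [cauchySeq_iff_tendsto, uniformity_eq_comap_nhds_zero, tendsto_comap_iff,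
      (PolynormableSpace.withSeminorms ℝ V).tendsto_nhds]
    rintro ⟨p, hp⟩ ε hε
    -- Two Riemann sums are compared, each with error `η (b - a)`; the `+ 1` covers `a = b`.
    have hη : 0 < ε / (2 * (b - a) + 1) := by positivity
    have h1 := herr p hp _ hη
    rw [← prod_atTop_atTop_eq]
    filter_upwards [h1.prod_mk h1] with q hq
    obtain ⟨φ, h2, h3⟩ := exists_clm_eq_seminorm p hp (R q.2 - R q.1)
    have h4 := hq.1 φ h2
    have h5 := hq.2 φ h2
    have h6 : ε / (2 * (b - a) + 1) * (b - a) * 2 < ε := by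
      rw [div_mul_eq_mul_div, div_mul_eq_mul_div, div_lt_iff₀ (by positivity)]
      nlinarith
    simp only [sub_zero, Function.comp_apply, Prod.map_fst, Prod.map_snd]
    rw [← h3, map_sub]
    rw [abs_le] at h4 h5
    linarith [h4.1, h4.2, h5.1, h5.2]
  obtain ⟨I, hI⟩ := cauchySeq_tendsto_of_complete hcauchy
  refine ⟨I, fun φ => ⟨ContinuousOn.intervalIntegrable ?_, ?_⟩⟩
  · rw [uIcc_of_le hab]
    exact φ.continuous.comp_continuousOn hf
  · refine tendsto_nhds_unique ?_ ((φ.continuous.tendsto I).comp hI)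
    rw [Metric.tendsto_nhds]
    intro ε hε
    -- The limit is tested with `φ` itself, dominated by the seminorm `|φ|`.
    let p : Seminorm ℝ V := (normSeminorm ℝ ℝ).comp φ.toLinearMap
    have hp : Continuous p := φ.continuous.norm
    have hη : 0 < ε / ((b - a) + 1) := by positivity
    filter_upwards [herr p hp _ hη] with n hn
    refine (hn φ fun y => le_rfl).trans_lt ?_
    rw [div_mul_eq_mul_div, div_lt_iff₀ (by positivity)]
    nlinarith

/-- The inner integral is Lipschitz in its upper limit with respect to every continuous seminorm,
hence continuous and integrable in turn. -/
theorem exists_isDoubleIntegral [CompleteSpace V] {t : ℝ} (ht : 0 ≤ t)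
    (hf : ContinuousOn f (Icc 0 t)) : ∃ I, IsDoubleIntegral f t I := by
  have h1 : ∀ τ : ℝ, ∃ I, τ ∈ Icc 0 t → IsIntegral f 0 τ I := fun τ => by
    by_cases hτ : τ ∈ Icc 0 t
    · obtain ⟨I, hI⟩ := exists_isIntegral hτ.1 (hf.mono (Icc_subset_Icc_right hτ.2))
      exact ⟨I, fun _ => hI⟩
    · exact ⟨0, fun h => (hτ h).elim⟩
  choose g hg using h1
  suffices hgc : ContinuousOn g (Icc 0 t) by
    obtain ⟨I, hI⟩ := exists_isIntegral ht hgc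
    exact ⟨I, g, hg, hI⟩
  intro σ hσ
  rw [ContinuousWithinAt, (PolynormableSpace.withSeminorms ℝ V).tendsto_nhds]
  rintro ⟨p, hp⟩ ε hε
  obtain ⟨c, hc⟩ := (isCompact_Icc.image_of_continuousOn
    (hp.comp_continuousOn hf)).bddAbove
  have hc' : ∀ τ ∈ Icc 0 t, p (f τ) ≤ c := fun τ hτ => hc (mem_image_of_mem _ hτ)
  have hc0 : 0 ≤ c := (apply_nonneg p _).trans (hc' 0 ⟨le_rfl, ht⟩)
  have hlip : ∀ x ∈ Icc 0 t, ∀ y ∈ Icc 0 t, x ≤ y → p (g y - g x) ≤ c * (y - x) :=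
    fun x hx y hy hxy => ((hg x hx).interval_sub (hg y hy)).seminorm_le hxy hp fun τ hτ =>
      hc' τ ⟨hx.1.trans hτ.1, hτ.2.trans hy.2⟩
  filter_upwards [self_mem_nhdsWithin, mem_nhdsWithin_of_mem_nhds
    (Metric.ball_mem_nhds σ (show 0 < ε / (c + 1) by positivity))] with τ hτ hτσ
  rw [Metric.mem_ball, Real.dist_eq, lt_div_iff₀ (by positivity)] at hτσ
  have habs : p (g τ - g σ) ≤ c * |τ - σ| := by
    rcases le_total σ τ with h | h
    · rw [abs_of_nonneg (sub_nonneg.2 h)]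
      exact hlip σ hσ τ hτ h
    · rw [abs_sub_comm, abs_of_nonneg (sub_nonneg.2 h), map_sub_rev]
      exact hlip τ hτ σ hσ h
  refine habs.trans_lt ?_
  nlinarith [abs_nonneg (τ - σ)]

end Complete

end Integrals

/-! ### First-order bounds by compactness. -/

section FirstOrder

variable {E : Type*} [AddCommGroup E] [Module ℝ E] [TopologicalSpace E]
  [IsTopologicalAddGroup E] [ContinuousSMul ℝ E]
variable {F : Type*} [AddCommGroup F] [Module ℝ F] [TopologicalSpace F]
  [IsTopologicalAddGroup F] [ContinuousSMul ℝ F] [T2Space F] [LocallyConvexSpace ℝ F]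

/-- First-order bound for the increments of a `C¹` map along rays starting at the origin. -/
theorem CnOn.exists_seminorm_sub_le {f : E → F} {U K K₁ : Set E} (hf : CnOn F 1 f U)
    (hK : IsCompact K) (hKU : K ⊆ U) (hK₁ : IsCompact K₁) {p : Seminorm ℝ F} (hp : Continuous p) :
    ∃ C : ℝ, 0 ≤ C ∧ ∀ k ∈ K₁, ∀ t : ℝ, 0 ≤ t → (∀ r ∈ Icc (0 : ℝ) 1, (r * t) • k ∈ K) →
      p (f (t • k) - f 0) ≤ C * t := by
  have hc : ContinuousOn (fun q : E × E => p (D f q.1 q.2)) (K ×ˢ K₁) :=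
    hp.comp_continuousOn (ContinuousOn.mono hf.2.2 (prod_mono hKU (subset_univ _)))
  obtain ⟨C₀, hC₀⟩ := ((hK.prod hK₁).image_of_continuousOn hc).bddAbove
  obtain ⟨C, hC0, hC⟩ : ∃ C, 0 ≤ C ∧
      C ∈ upperBounds ((fun q : E × E => p (D f q.1 q.2)) '' K ×ˢ K₁) :=
    ⟨max C₀ 0, le_max_right _ _, fun _ h => (hC₀ h).trans (le_max_left _ _)⟩
  refine ⟨C, hC0, fun k hk t ht hr => ?_⟩
  -- The mean value theorem is applied with a closed seminorm ball as the closed convex set.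
  have hconv : Convex ℝ (p.closedBall 0 (C * t)) := p.convex_closedBall _ _
  have hclosed : IsClosed (p.closedBall 0 (C * t)) := by
    simp only [Seminorm.closedBall, sub_zero]
    exact isClosed_le hp continuous_const
  have key := sub_mem_of_hasDerivAt (f := fun r : ℝ => f ((r * t) • k)) hconv hclosed
    (f' := fun r => t • D f ((r * t) • k) k) (fun r h => ?_) (fun r h => ?_)
  · simpa [Seminorm.mem_closedBall] using key
  · have h1 := hf.hasDerivAt_line (x := 0) (h := k) (r := r * t) (by simpa using hKU (hr r h))
    have hc : HasDerivAt (fun r : ℝ => r * t) t r := by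
      simpa using (hasDerivAt_id r).mul_const t
    simpa using h1.tvs_scomp (x := r) (c := fun r => r * t) hc
  · rw [Seminorm.mem_closedBall, sub_zero, map_smul_eq_mul, Real.norm_of_nonneg ht, mul_comm]
    exact mul_le_mul_of_nonneg_right
      (hC (mem_image_of_mem (fun q : E × E => p (D f q.1 q.2)) (Set.mk_mem_prod (hr r h) hk))) ht

end FirstOrder

/-! ### Flows and their linearizations. -/

section Flow

variable {V : Type*} [AddCommGroup V] [Module ℝ V] [TopologicalSpace V]
  [IsTopologicalAddGroup V] [ContinuousSMul ℝ V] [T2Space V] [LocallyConvexSpace ℝ V]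
variable {X : Type*} [AddCommGroup X] [Module ℝ X] [TopologicalSpace X]
  [IsTopologicalAddGroup X] [ContinuousSMul ℝ X]
variable {n : ℕ} {G : V → V} {Dom : Set (ℝ × V)} {E : ℝ → V → V} {s t : ℝ} {x h k : V}

theorem D_eq_D_joint (E : ℝ → V → V) (s : ℝ) (x h : V) :
    D (E s) x h = D (fun p : ℝ × V => E p.1 p.2) (s, x) (0, h) := by
  simp [D]

theorem D2_eq_D2_joint (E : ℝ → V → V) (s : ℝ) (x h k : V) :
    D2 (E s) x h k = D2 (fun p : ℝ × V => E p.1 p.2) (s, x) (0, h) (0, k) := by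
  simp [D2, D]

namespace IsFlow

theorem isOpen_slice (hE : IsFlow n G Dom E) (s : ℝ) : IsOpen {x | (s, x) ∈ Dom} :=
  hE.isOpen.preimage (by fun_prop : Continuous fun x : V => (s, x))

theorem cnOn_comp (hE : IsFlow n G Dom E) {s : X → ℝ} {b : X → V} {W : Set X}
    (hs : CnOn ℝ n s W) (hb : CnOn V n b W) (hW : IsOpen W) (hm : ∀ z ∈ W, (s z, b z) ∈ Dom) :
    CnOn V n (fun z => E (s z) (b z)) W :=
  hE.smooth.comp (hs.prodMk hb hW) hE.isOpen hW hm

theorem cnOn_D (hE : IsFlow (n + 1) G Dom E) {s : X → ℝ} {b d : X → V} {W : Set X}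
    (hs : CnOn ℝ n s W) (hb : CnOn V n b W) (hd : CnOn V n d W) (hW : IsOpen W)
    (hm : ∀ z ∈ W, (s z, b z) ∈ Dom) : CnOn V n (fun z => D (E (s z)) (b z) (d z)) W := by
  simp only [D_eq_D_joint]
  exact hE.smooth.D_comp (hs.prodMk hb hW) ((cnOn_const 0 W).prodMk hd hW) hE.isOpen hW hm

theorem cnOn_D2 (hE : IsFlow (n + 2) G Dom E) {s : X → ℝ} {b d e : X → V} {W : Set X}
    (hs : CnOn ℝ n s W) (hb : CnOn V n b W) (hd : CnOn V n d W) (he : CnOn V n e W) (hW : IsOpen W)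
    (hm : ∀ z ∈ W, (s z, b z) ∈ Dom) : CnOn V n (fun z => D2 (E (s z)) (b z) (d z) (e z)) W := by
  simp only [D2_eq_D2_joint]
  exact hE.smooth.D2_comp (hs.prodMk hb hW) ((cnOn_const 0 W).prodMk hd hW)
    ((cnOn_const 0 W).prodMk he hW) hE.isOpen hW hm

theorem cnOn_slice (hE : IsFlow n G Dom E) (s : ℝ) : CnOn V n (E s) {x | (s, x) ∈ Dom} :=
  hE.cnOn_comp (cnOn_const s _) (cnOn_clm (ContinuousLinearMap.id ℝ V) _) (hE.isOpen_slice s)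
    fun _ hx => hx

theorem D_joint_one (hE : IsFlow (n + 1) G Dom E) (hx : (s, x) ∈ Dom) :
    D (fun p : ℝ × V => E p.1 p.2) (s, x) (1, 0) = G (E s x) := by
  refine D_eq_of_hasDerivAt ?_
  have h2 : HasDerivAt (fun r : ℝ => s + r • (1 : ℝ)) 1 0 := hasDerivAt_add_smul s 1 0
  simpa using HasDerivAt.tvs_scomp (f := fun s => E s x) (c := fun r : ℝ => s + r • (1 : ℝ))
    (x := 0) (by simpa using hE.ode s x hx) h2

theorem D_joint (hE : IsFlow (n + 1) G Dom E) (hx : (s, x) ∈ Dom) (σ : ℝ) (h : V) :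
    D (fun p : ℝ × V => E p.1 p.2) (s, x) (σ, h) = σ • G (E s x) + D (E s) x h := by
  have : (σ, h) = σ • ((1 : ℝ), (0 : V)) + ((0 : ℝ), h) := by simp
  rw [this, hE.smooth.D_add hE.isOpen hx, hE.smooth.D_smul hx, hE.D_joint_one hx, D_eq_D_joint]

theorem hasDerivAt_comp (hE : IsFlow (n + 1) G Dom E) {s : ℝ → ℝ} {b : ℝ → V} {s' r : ℝ} {b' : V}
    (hs : HasDerivAt s s' r) (hb : HasDerivAt b b' r) (hm : (s r, b r) ∈ Dom) :
    HasDerivAt (fun r => E (s r) (b r)) (s' • G (E (s r) (b r)) + D (E (s r)) (b r) b') r := by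
  rw [← hE.D_joint hm]
  exact hE.smooth.hasDerivAt_comp hE.isOpen (hs.tvs_prodMk hb) hm

/-- The linearized flow transports the vector field. -/
theorem D_field (hE : IsFlow (n + 1) G Dom E) (hx : (s, x) ∈ Dom) :
    D (E s) x (G x) = G (E s x) := by
  have h0 := hE.zero_mem x
  -- Both sides are the derivative at `r = 0` of the same curve, written as `E s (E r x)` and as `E
  -- (s + r) x`.
  have h1 : HasDerivAt (fun r => E s (E r x)) (D (E s) x (G x)) 0 := by
    have := (hE.cnOn_slice s).hasDerivAt_comp (hE.isOpen_slice s) (hE.ode 0 x h0)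
      (by simpa [hE.zero] using hx)
    simpa [hE.zero] using this
  have h2 : HasDerivAt (fun r => E (s + r) x) (G (E s x)) 0 := by
    have hs : HasDerivAt (fun r : ℝ => s + r) 1 0 := by
      simpa using (hasDerivAt_id (0 : ℝ)).const_add s
    simpa using HasDerivAt.tvs_scomp (f := fun s => E s x) (c := fun r : ℝ => s + r) (x := 0)
      (by simpa using hE.ode s x hx) hs
  refine h1.tvs_unique (h2.tvs_congr ?_)
  have h3 : ∀ᶠ r : ℝ in 𝓝 0, (r, x) ∈ Dom :=
    (by fun_prop : ContinuousAt (fun r : ℝ => (r, x)) 0).eventually (hE.isOpen.mem_nhds h0)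
  have h4 : ∀ᶠ r : ℝ in 𝓝 0, (s + r, x) ∈ Dom :=
    (by fun_prop : ContinuousAt (fun r : ℝ => (s + r, x)) 0).eventually
      (hE.isOpen.mem_nhds (by simpa using hx))
  filter_upwards [h3, h4] with r h5 h6
  exact (hE.add r s x h5 ((hE.mem_iff r s x h5).2 h6)).symm

/-- Obtained by differentiating the transport identity `D_field` with respect to the initial value.
-/
theorem D2_field (hE : IsFlow (n + 2) G Dom E) (hG : CnOn V (n + 1) G univ) (hx : (s, x) ∈ Dom)
    (h : V) :
    D2 (E s) x (G x) h + D (E s) x (D G x h) = D G (E s x) (D (E s) x h) := by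
  have hb := hasDerivAt_add_smul x h 0
  have hx0 : x + (0 : ℝ) • h ∈ {x | (s, x) ∈ Dom} := by simpa using hx
  have h1 := (hE.cnOn_slice s).hasDerivAt_D_comp (hE.isOpen_slice s) hb
    (hG.hasDerivAt_comp isOpen_univ hb (mem_univ _)) hx0
  have h2 := hG.hasDerivAt_comp isOpen_univ ((hE.cnOn_slice s).hasDerivAt_comp
    (hE.isOpen_slice s) hb hx0) (mem_univ _)
  simp only [zero_smul, add_zero] at h1 h2
  refine h1.tvs_unique (h2.tvs_congr ?_)
  filter_upwards [eventually_add_smul_mem (hE.isOpen_slice s) hx h] with r hr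
  exact hE.D_field hr

/-- The variational equation: by symmetry the time derivative may be taken first, and it is `G ∘ E
s`, which is then differentiated in the direction `h`. -/
theorem D2_joint_zero_one (hE : IsFlow (n + 2) G Dom E) (hG : CnOn V (n + 1) G univ)
    (hx : (s, x) ∈ Dom) (h : V) :
    D2 (fun p : ℝ × V => E p.1 p.2) (s, x) (0, h) (1, 0) = D G (E s x) (D (E s) x h) := by
  rw [hE.smooth.D2_symm hE.isOpen hx]
  refine D_eq_of_hasDerivAt ?_
  have hb := hasDerivAt_add_smul x h 0
  have hx0 : x + (0 : ℝ) • h ∈ {x | (s, x) ∈ Dom} := by simpa using hx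
  have h2 := hG.hasDerivAt_comp isOpen_univ ((hE.cnOn_slice s).hasDerivAt_comp
    (hE.isOpen_slice s) hb hx0) (mem_univ _)
  simp only [zero_smul, add_zero] at h2
  refine h2.tvs_congr ?_
  filter_upwards [eventually_add_smul_mem (hE.isOpen_slice s) hx h] with r hr
  simpa using hE.D_joint_one hr

theorem hasDerivAt_D_comp (hE : IsFlow (n + 2) G Dom E) (hG : CnOn V (n + 1) G univ) {s : ℝ → ℝ}
    {b d : ℝ → V} {s' r : ℝ} {b' d' : V} (hs : HasDerivAt s s' r) (hb : HasDerivAt b b' r)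
    (hd : HasDerivAt d d' r) (hm : (s r, b r) ∈ Dom) :
    HasDerivAt (fun r => D (E (s r)) (b r) (d r))
      (s' • D G (E (s r) (b r)) (D (E (s r)) (b r) (d r)) + D2 (E (s r)) (b r) (d r) b'
        + D (E (s r)) (b r) d') r := by
  have h1 := hE.smooth.hasDerivAt_D_comp hE.isOpen (hs.tvs_prodMk hb)
    ((hasDerivAt_const_tvs (0 : ℝ) r).tvs_prodMk hd) hm
  obtain ⟨L, hL⟩ := hE.smooth.exists_clm_D2 hE.isOpen hm (0, d r)
  have : (s', b') = s' • ((1 : ℝ), (0 : V)) + ((0 : ℝ), b') := by simp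
  rw [← hL, this, map_add, map_smul, hL, hL, ← D2_eq_D2_joint, ← D_eq_D_joint,
    hE.D2_joint_zero_one hG hm] at h1
  simp only [D_eq_D_joint E] at h1 ⊢
  exact h1

/-- Derivative of the linearized backward flow along curves. -/
theorem hasDerivAt_D_sub (hE : IsFlow (n + 2) G Dom E) (hG : CnOn V (n + 1) G univ) {t r : ℝ}
    {b d : ℝ → V} {b' d' : V} (hb : HasDerivAt b b' r) (hd : HasDerivAt d d' r)
    (hm : (t - r, b r) ∈ Dom) :
    HasDerivAt (fun r => D (E (t - r)) (b r) (d r))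
      (D (E (t - r)) (b r) (d' - D G (b r) (d r))
        + D2 (E (t - r)) (b r) (d r) (b' - G (b r))) r := by
  have hs : HasDerivAt (fun r : ℝ => t - r) (-1) r := by
    simpa using (hasDerivAt_id r).const_sub t
  have h1 := hE.hasDerivAt_D_comp hG hs hb hd hm
  obtain ⟨L, hL⟩ := (hE.cnOn_slice (t - r)).exists_clm_D2 (hE.isOpen_slice _) hm (d r)
  obtain ⟨M, hM⟩ := (hE.cnOn_slice (t - r)).exists_clm (hE.isOpen_slice _) hm
  -- The term `-D G (E (t - r) (b r)) (…)` from the backward time is pulled back to the base point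
  -- `b r`, where it combines with `d'` and `b'`.
  have h2 := hE.D2_field hG hm (d r)
  rw [(hE.cnOn_slice (t - r)).D2_symm (hE.isOpen_slice _) hm] at h2
  rw [← h2] at h1
  simp only [← hL, ← hM, map_sub] at h1 ⊢
  convert h1 using 1
  module

/-- The second variational equation. Symmetry moves the time derivative inside the direction `k`,
where the first variational equation replaces it by an expression to be differentiated along `k`. -/
theorem hasDerivAt_D2 (hE : IsFlow (n + 3) G Dom E) (hG : CnOn V (n + 2) G univ)
    (hm : (s, x) ∈ Dom) (h k : V) :
    HasDerivAt (fun s => D2 (E s) x h k)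
      (D2 G (E s x) (D (E s) x h) (D (E s) x k) + D G (E s x) (D2 (E s) x h k)) s := by
  have hH := hE.smooth.D_apply hE.isOpen ((0 : ℝ), h)
  have hs : HasDerivAt (fun r : ℝ => (r, x)) ((1 : ℝ), (0 : V)) s :=
    (hasDerivAt_id s).tvs_prodMk (hasDerivAt_const_tvs x s)
  have h1 := (hH.D_apply hE.isOpen ((0 : ℝ), k)).hasDerivAt_comp hE.isOpen hs hm
  have h2 : D2 (fun p => D (fun p : ℝ × V => E p.1 p.2) p (0, h)) (s, x) (1, 0) (0, k) =
      D2 G (E s x) (D (E s) x h) (D (E s) x k) + D G (E s x) (D2 (E s) x h k) := by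
    refine D_eq_of_hasDerivAt ?_
    have hb := hasDerivAt_add_smul x k 0
    have hx0 : x + (0 : ℝ) • k ∈ {x | (s, x) ∈ Dom} := by simpa using hm
    have h3 := hG.hasDerivAt_D_comp isOpen_univ
      ((hE.cnOn_slice s).hasDerivAt_comp (hE.isOpen_slice s) hb hx0)
      (((hE.cnOn_slice s).D_apply (hE.isOpen_slice s) h).hasDerivAt_comp (hE.isOpen_slice s) hb hx0)
      (mem_univ _)
    simp only [zero_smul, add_zero] at h3
    refine h3.tvs_congr ?_
    filter_upwards [eventually_add_smul_mem (hE.isOpen_slice s) hm k] with r hr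
    have h4 := hE.hasDerivAt_D_comp hG (hasDerivAt_id s)
      (hasDerivAt_const_tvs (x + r • k) s) (hasDerivAt_const_tvs h s) hr
    have h5 := hH.hasDerivAt_comp hE.isOpen
      ((hasDerivAt_id s).tvs_prodMk (hasDerivAt_const_tvs (x + r • k) s)) hr
    simp only [id, ← D_eq_D_joint] at h5 h4
    obtain ⟨L, hL⟩ := (hE.cnOn_slice s).exists_clm_D2 (hE.isOpen_slice _) hr h
    have h6 := h5.tvs_unique h4
    rw [← hL, map_zero, (hE.cnOn_slice s).D_zero (hE.isOpen_slice _) hr] at h6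
    simpa using h6
  rw [← h2, hH.D2_symm hE.isOpen hm]
  simp only [D2_eq_D2_joint E]
  exact h1

end IsFlow

end Flow

/-! ### The linear group and expanded commutators. -/

section Group

variable {V : Type*} [AddCommGroup V] [Module ℝ V] [TopologicalSpace V]
  [IsTopologicalAddGroup V] [ContinuousSMul ℝ V] [T2Space V] [LocallyConvexSpace ℝ V]
variable {X : Type*} [AddCommGroup X] [Module ℝ X] [TopologicalSpace X]
  [IsTopologicalAddGroup X] [ContinuousSMul ℝ X]
variable {A : V →L[ℝ] V} {B : V → V} {EA : ℝ → V →L[ℝ] V} {n : ℕ}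

theorem IsFlow.of_le {G : V → V} {Dom : Set (ℝ × V)} {E : ℝ → V → V} {m : ℕ}
    (hE : IsFlow n G Dom E) (hm : m ≤ n) : IsFlow m G Dom E :=
  { hE with smooth := hE.smooth.of_le hm }

theorem CnOn.half {s : X → ℝ} {W : Set X} (hs : CnOn ℝ n s W) (hW : IsOpen W) :
    CnOn ℝ n (fun z => s z / 2) W := by
  have := hs.const_smul hW (2⁻¹ : ℝ)
  simpa [div_eq_inv_mul] using this

section

variable (hEA : IsFlow (n + 1) (fun x => A x) univ (fun t x => EA t x))
include hEA

/-- The transport identity `D_field` for a linear flow, which is its own linearization. -/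
theorem group_comm (t : ℝ) (x : V) : A (EA t x) = EA t (A x) :=
  (hEA.D_field (mem_univ (t, x))).symm.trans (D_clm (EA t) x (A x))

theorem hasDerivAt_group {s : ℝ → ℝ} {b : ℝ → V} {s' r : ℝ} {b' : V}
    (hs : HasDerivAt s s' r) (hb : HasDerivAt b b' r) :
    HasDerivAt (fun r => EA (s r) (b r)) (EA (s r) (s' • A (b r) + b')) r := by
  have := hEA.hasDerivAt_comp hs hb (mem_univ _)
  rw [group_comm hEA, D_clm] at this
  simpa using this

end

section Commutators

variable (hB : CnOn V (n + 2) B univ)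
include hB

theorem comm_clm_left (y : V) : comm A B y = A (B y) - D B y (A y) := by
  rw [comm, D_clm]

theorem comm_clm_right (y : V) : comm B A y = D B y (A y) - A (B y) := by
  rw [comm, D_clm]

theorem D_comm_clm_right (y h : V) :
    D (comm B A) y h = D2 B y (A y) h + D B y (A h) - A (D B y h) := by
  have hb := hasDerivAt_add_smul y h 0
  have h1 := (hB.hasDerivAt_D_comp isOpen_univ hb (hb.tvs_comp_clm A) (mem_univ _)).tvs_sub
    ((hB.hasDerivAt_comp isOpen_univ hb (mem_univ _)).tvs_comp_clm A)
  simp only [zero_smul, add_zero] at h1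
  refine D_eq_of_hasDerivAt (h1.tvs_congr (Eventually.of_forall fun s => ?_))
  exact comm_clm_right hB _

theorem D_comm_clm_left (y h : V) :
    D (comm A B) y h = A (D B y h) - D2 B y (A y) h - D B y (A h) := by
  have hb := hasDerivAt_add_smul y h 0
  have h1 := ((hB.hasDerivAt_comp isOpen_univ hb (mem_univ _)).tvs_comp_clm A).tvs_sub
    (hB.hasDerivAt_D_comp isOpen_univ hb (hb.tvs_comp_clm A) (mem_univ _))
  simp only [zero_smul, add_zero, ← sub_sub] at h1
  refine D_eq_of_hasDerivAt (h1.tvs_congr (Eventually.of_forall fun s => ?_))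
  exact comm_clm_left hB _

/-- Iterated commutators are expanded into words in `A`, `D B y` and `D2 B y`; the later comparisons
of integrands with derivatives of primitives then become linear identities. -/
theorem comm_clm_comm_right (y : V) :
    comm A (comm B A) y =
      (2 : ℝ) • A (D B y (A y)) - A (A (B y)) - D2 B y (A y) (A y) - D B y (A (A y)) := by
  rw [comm, D_clm, D_comm_clm_right hB, comm_clm_right hB, map_sub]
  module

theorem comm_clm_comm_left (y : V) :
    comm A (comm A B) y =
      A (A (B y)) - (2 : ℝ) • A (D B y (A y)) + D2 B y (A y) (A y) + D B y (A (A y)) := by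
  rw [comm, D_clm, D_comm_clm_left hB, comm_clm_left hB, map_sub]
  module

theorem comm_comm_right (y : V) :
    comm B (comm B A) y =
      D B y (D B y (A y)) - (2 : ℝ) • D B y (A (B y)) - D2 B y (A y) (B y) + A (D B y (B y)) := by
  rw [comm, D_comm_clm_right hB, comm_clm_right hB, hB.D_sub isOpen_univ (mem_univ _)]
  module

end Commutators

end Group

/-! ### Closed forms and regularity of the defects and integrands. -/

section Defects

variable {V : Type*} [AddCommGroup V] [Module ℝ V] [TopologicalSpace V]
  [IsTopologicalAddGroup V] [ContinuousSMul ℝ V] [T2Space V] [LocallyConvexSpace ℝ V]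
variable {X : Type*} [AddCommGroup X] [Module ℝ X] [TopologicalSpace X]
  [IsTopologicalAddGroup X] [ContinuousSMul ℝ X]
variable {A : V →L[ℝ] V} {B : V → V} {EA : ℝ → V →L[ℝ] V} {EB : ℝ → V → V}
  {DomB : Set (ℝ × V)} {u : V}

/-- The inner stage `E_B(t, E_A(t/2) u)` of the splitting step. -/
noncomputable def inner (EA : ℝ → V →L[ℝ] V) (EB : ℝ → V → V) (u : V) (t : ℝ) : V :=
  EB t (EA (t / 2) u)

/-- The derivative of the inner stage in the direction `A E_A(t/2) u`. -/
noncomputable def innerD (A : V →L[ℝ] V) (EA : ℝ → V →L[ℝ] V) (EB : ℝ → V → V) (u : V) (t : ℝ) :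
    V :=
  D (EB t) (EA (t / 2) u) (A (EA (t / 2) u))

variable (hB : CnOn V 3 B univ) (hEA : IsFlow 3 (fun x => A x) univ (fun t x => EA t x))
  (hEB : IsFlow 3 B DomB EB)

include hEA in
theorem hasDerivAt_half (u : V) (t : ℝ) :
    HasDerivAt (fun t => EA (t / 2) u) ((1 / 2 : ℝ) • A (EA (t / 2) u)) t := by
  have := hasDerivAt_group hEA ((hasDerivAt_id t).div_const 2) (hasDerivAt_const_tvs u t)
  simpa [group_comm hEA] using this

include hEA hEB in
theorem hasDerivAt_inner {t : ℝ} (ht : (t, EA (t / 2) u) ∈ DomB) :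
    HasDerivAt (inner EA EB u)
      (B (inner EA EB u t) + (1 / 2 : ℝ) • innerD A EA EB u t) t := by
  have := hEB.hasDerivAt_comp (hasDerivAt_id t) (hasDerivAt_half hEA u t) ht
  simp only [id] at this
  rw [one_smul, (hEB.cnOn_slice _).D_smul ht] at this
  exact this

include hEA hEB in
theorem hasDerivAt_step {t : ℝ} (ht : (t, EA (t / 2) u) ∈ DomB) :
    HasDerivAt (fun t => step EA EB t u) (EA (t / 2) ((1 / 2 : ℝ) • A (inner EA EB u t) +
      (B (inner EA EB u t) + (1 / 2 : ℝ) • innerD A EA EB u t))) t :=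
  hasDerivAt_group hEA ((hasDerivAt_id t).div_const 2) (hasDerivAt_inner hEA hEB ht)

include hEA hEB in
-- The outer group contributes only half of `A S`; the other half is compensated by `innerD` up to
-- the difference in the last term.
theorem S1_eq {t : ℝ} (ht : (t, EA (t / 2) u) ∈ DomB) :
    S1 A B EA EB t u = EA (t / 2) (B (inner EA EB u t)) - B (step EA EB t u)
      + (1 / 2 : ℝ) • EA (t / 2) (innerD A EA EB u t - A (inner EA EB u t)) := by
  have h1 : step EA EB t u = EA (t / 2) (inner EA EB u t) := rfl
  rw [S1, (hasDerivAt_step hEA hEB ht).tvs_deriv, field]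
  nth_rewrite 1 [h1]
  simp only [map_add, map_sub, map_smul, group_comm hEA]
  module

include hB hEA hEB in
theorem hasDerivAt_innerD {t : ℝ} (ht : (t, EA (t / 2) u) ∈ DomB) :
    HasDerivAt (innerD A EA EB u) (D B (inner EA EB u t) (innerD A EA EB u t)
      + (1 / 2 : ℝ) • D2 (EB t) (EA (t / 2) u) (A (EA (t / 2) u)) (A (EA (t / 2) u))
      + (1 / 2 : ℝ) • D (EB t) (EA (t / 2) u) (A (A (EA (t / 2) u)))) t := by
  have hv := hasDerivAt_half hEA u t
  have := hEB.hasDerivAt_D_comp (hB.of_le (by norm_num)) (hasDerivAt_id t) hv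
    (hv.tvs_comp_clm A) ht
  obtain ⟨L, hL⟩ := (hEB.cnOn_slice t).exists_clm_D2 (hEB.isOpen_slice t) ht (A (EA (t / 2) u))
  simp only [id] at this
  rw [one_smul, map_smul, (hEB.cnOn_slice _).D_smul ht, ← hL, map_smul, hL] at this
  exact this

include hEA hEB in
theorem isOpen_times (u : V) : IsOpen {t : ℝ | (t, EA (t / 2) u) ∈ DomB} := by
  have h : Continuous fun t : ℝ => EA (t / 2) u :=
    continuous_iff_continuousAt.2 fun t => (hasDerivAt_half hEA u t).tvs_continuousAt
  exact hEB.isOpen.preimage (continuous_id.prodMk h)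

include hB hEA hEB in
theorem hasDerivAt_S1 {t : ℝ} (ht : (t, EA (t / 2) u) ∈ DomB) :
    HasDerivAt (fun t => S1 A B EA EB t u)
      (EA (t / 2) ((1 / 2 : ℝ) • A (B (inner EA EB u t)) +
          D B (inner EA EB u t) (B (inner EA EB u t) + (1 / 2 : ℝ) • innerD A EA EB u t))
        - D B (step EA EB t u) (EA (t / 2) ((1 / 2 : ℝ) • A (inner EA EB u t) +
            (B (inner EA EB u t) + (1 / 2 : ℝ) • innerD A EA EB u t)))
        + (1 / 2 : ℝ) • EA (t / 2)
          ((1 / 2 : ℝ) • A (innerD A EA EB u t - A (inner EA EB u t)) +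
          (D B (inner EA EB u t) (innerD A EA EB u t)
            + (1 / 2 : ℝ) • D2 (EB t) (EA (t / 2) u) (A (EA (t / 2) u)) (A (EA (t / 2) u))
            + (1 / 2 : ℝ) • D (EB t) (EA (t / 2) u) (A (A (EA (t / 2) u)))
            - A (B (inner EA EB u t) + (1 / 2 : ℝ) • innerD A EA EB u t)))) t := by
  have hh : HasDerivAt (fun t : ℝ => t / 2) (1 / 2) t := (hasDerivAt_id t).div_const 2
  have hw := hasDerivAt_inner hEA hEB ht
  have h1 := hasDerivAt_group hEA hh (hB.hasDerivAt_comp isOpen_univ hw (mem_univ _))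
  have h2 := hB.hasDerivAt_comp isOpen_univ (hasDerivAt_step hEA hEB ht) (mem_univ _)
  have h3 := (hasDerivAt_group hEA hh
    ((hasDerivAt_innerD hB hEA hEB ht).tvs_sub (hw.tvs_comp_clm A))).tvs_const_smul (1 / 2 : ℝ)
  refine ((h1.tvs_sub h2).tvs_add h3).tvs_congr ?_
  filter_upwards [(isOpen_times hEA hEB u).mem_nhds ht] with s hs
  exact S1_eq hEA hEB hs

include hB in
theorem D_field_eq (x h : V) : D (field A B) x h = A h + D B x h := by
  refine D_eq_of_hasDerivAt ((hasDerivAt_clm A x h 0).tvs_add ?_)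
  have := hB.hasDerivAt_line (x := x) (h := h) (r := 0) (mem_univ _)
  simpa using this

include hB hEA hEB in
-- The terms are grouped as the boundary values of the primitives differentiated in
-- `hasDerivAt_s2_left` and `hasDerivAt_s2_right`.
theorem S2_eq {t : ℝ} (ht : (t, EA (t / 2) u) ∈ DomB) :
    S2 A B EA EB t u =
      A (B (step EA EB t u)) + D B (step EA EB t u) (B (step EA EB t u) - A (step EA EB t u)
          - EA (t / 2) (innerD A EA EB u t - A (inner EA EB u t))
          - (2 : ℝ) • EA (t / 2) (B (inner EA EB u t)))
        + EA (t / 2) (D B (inner EA EB u t) (B (inner EA EB u t) + innerD A EA EB u t)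
          - A (B (inner EA EB u t))
          - (1 / 2 : ℝ) • A (innerD A EA EB u t) + (1 / 4 : ℝ) • A (A (inner EA EB u t))
          + (1 / 4 : ℝ) • D2 (EB t) (EA (t / 2) u) (A (EA (t / 2) u)) (A (EA (t / 2) u))
          + (1 / 4 : ℝ) • D (EB t) (EA (t / 2) u) (A (A (EA (t / 2) u)))) := by
  have h1 : step EA EB t u = EA (t / 2) (inner EA EB u t) := rfl
  rw [S2, (hasDerivAt_S1 hB hEA hEB ht).tvs_deriv, D_field_eq hB, S1_eq hEA hEB ht]
  obtain ⟨L, hL⟩ := hB.exists_clm isOpen_univ (mem_univ (step EA EB t u))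
  obtain ⟨M, hM⟩ := hB.exists_clm isOpen_univ (mem_univ (inner EA EB u t))
  simp only [← hL, ← hM, map_add, map_sub, map_smul, group_comm hEA]
  have h2 : L (A (step EA EB t u)) = L (EA (t / 2) (A (inner EA EB u t))) := by
    rw [h1, group_comm hEA]
  rw [h2]
  module

variable {W : Set X} {t τ : X → ℝ}

include hB hEA hEB in
theorem cnOn_S1 (u : V) :
    CnOn V 1 (fun t => S1 A B EA EB t u) {t : ℝ | (t, EA (t / 2) u) ∈ DomB} := by
  have hW := isOpen_times hEA hEB u
  have ht : CnOn ℝ 1 (fun t : ℝ => t) {t : ℝ | (t, EA (t / 2) u) ∈ DomB} :=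
    cnOn_clm (ContinuousLinearMap.id ℝ ℝ) _
  have hEA1 := hEA.of_le (m := 1) (by norm_num)
  have hv := hEA1.cnOn_comp (ht.half hW) (cnOn_const u _) hW fun _ _ => mem_univ _
  have hw : CnOn V 1 (inner EA EB u) {t : ℝ | (t, EA (t / 2) u) ∈ DomB} :=
    (hEB.of_le (m := 1) (by norm_num)).cnOn_comp ht hv hW fun _ hz => hz
  have hp : CnOn V 1 (innerD A EA EB u) {t : ℝ | (t, EA (t / 2) u) ∈ DomB} :=
    (hEB.of_le (m := 2) (by norm_num)).cnOn_D ht hv (hv.clm_comp hW A) hW fun _ hz => hz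
  have hB1 := hB.of_le (m := 1) (by norm_num)
  have hE : ∀ {b : ℝ → V}, CnOn V 1 b {t : ℝ | (t, EA (t / 2) u) ∈ DomB} →
      CnOn V 1 (fun t => EA (t / 2) (b t)) {t : ℝ | (t, EA (t / 2) u) ∈ DomB} := fun hb =>
    hEA1.cnOn_comp (ht.half hW) hb hW fun _ _ => mem_univ _
  refine CnOn.congr ?_ hW fun s hs => (S1_eq hEA hEB hs).symm
  exact ((hE (hB1.comp hw isOpen_univ hW fun _ _ => mem_univ _)).sub
    (hB1.comp (hE hw) isOpen_univ hW fun _ _ => mem_univ _) hW).add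
    ((hE (hp.sub (hw.clm_comp hW A) hW)).const_smul hW _) hW

include hEB in
theorem flow_mem_sub {v : V} {t τ : ℝ} (ht : (t, v) ∈ DomB) (hτ : (τ, v) ∈ DomB) :
    (t - τ, EB τ v) ∈ DomB := by
  rw [hEB.mem_iff τ (t - τ) v hτ, sub_add_cancel]
  exact ht

include hB hEA hEB in
theorem cnOn_s1 (hW : IsOpen W) (ht : CnOn ℝ 1 t W) (hτ : CnOn ℝ 1 τ W)
    (hmt : ∀ z ∈ W, (t z, EA (t z / 2) u) ∈ DomB) (hmτ : ∀ z ∈ W, (τ z, EA (t z / 2) u) ∈ DomB) :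
    CnOn V 1 (fun z => s1 A B EA EB (t z) (τ z) u) W := by
  have hEA1 := hEA.of_le (m := 1) (by norm_num)
  have hEB1 := hEB.of_le (m := 1) (by norm_num)
  have hE : ∀ {s : X → ℝ} {b : X → V}, CnOn ℝ 1 s W → CnOn V 1 b W →
      CnOn V 1 (fun z => EA (s z) (b z)) W := fun hs hb =>
    hEA1.cnOn_comp hs hb hW fun _ _ => mem_univ _
  have hA : ∀ {b : X → V}, CnOn V 1 b W → CnOn V 1 (fun z => A (b z)) W := fun hb =>
    hb.clm_comp hW A
  have hBc : ∀ {b : X → V}, CnOn V 1 b W → CnOn V 1 (fun z => B (b z)) W := fun hb =>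
    (hB.of_le (m := 1) (by norm_num)).comp hb isOpen_univ hW fun _ _ => mem_univ _
  have hDB : ∀ {b d : X → V}, CnOn V 1 b W → CnOn V 1 d W → CnOn V 1 (fun z => D B (b z) (d z)) W :=
    fun hb hd => (hB.of_le (m := 2) (by norm_num)).D_comp hb hd isOpen_univ hW fun _ _ => mem_univ _
  have hv := hE (ht.half hW) (cnOn_const u W)
  have hw := hEB1.cnOn_comp ht hv hW hmt
  have hx := hE (hτ.half hW) hw
  have hy := hEB1.cnOn_comp hτ hv hW hmτ
  simp only [s1, comm_clm_left hB, comm_clm_right hB]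
  exact ((hE ((ht.sub hτ hW).half hW) ((hA (hBc hx)).sub (hDB hx (hA hx)) hW)).const_smul hW _).add
    ((hE (ht.half hW) ((hEB.of_le (m := 2) (by norm_num)).cnOn_D (ht.sub hτ hW) hy
      ((hDB hy (hA hy)).sub (hA (hBc hy)) hW) hW
      fun z hz => flow_mem_sub hEB (hmt z hz) (hmτ z hz))).const_smul hW _) hW

include hB hEA hEB in
-- The times are functions on an arbitrary parameter space, so that one statement covers fixed `t`,
-- the pair `(t, τ)` and the triple `(t, τ, σ)`. Since `D2 B` occurs, class `C³` of `B` leaves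
-- exactly `C¹`.
theorem cnOn_s2 (hW : IsOpen W) (ht : CnOn ℝ 1 t W) (hτ : CnOn ℝ 1 τ W)
    (hmt : ∀ z ∈ W, (t z, EA (t z / 2) u) ∈ DomB) (hmτ : ∀ z ∈ W, (τ z, EA (t z / 2) u) ∈ DomB) :
    CnOn V 1 (fun z => s2 A B EA EB (t z) (τ z) u) W := by
  have hEA1 := hEA.of_le (m := 1) (by norm_num)
  have hEB1 := hEB.of_le (m := 1) (by norm_num)
  have hEB2 := hEB.of_le (m := 2) (by norm_num)
  have hE : ∀ {s : X → ℝ} {b : X → V}, CnOn ℝ 1 s W → CnOn V 1 b W →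
      CnOn V 1 (fun z => EA (s z) (b z)) W := fun hs hb =>
    hEA1.cnOn_comp hs hb hW fun _ _ => mem_univ _
  have hA : ∀ {b : X → V}, CnOn V 1 b W → CnOn V 1 (fun z => A (b z)) W := fun hb =>
    hb.clm_comp hW A
  have hBc : ∀ {b : X → V}, CnOn V 1 b W → CnOn V 1 (fun z => B (b z)) W := fun hb =>
    (hB.of_le (m := 1) (by norm_num)).comp hb isOpen_univ hW fun _ _ => mem_univ _
  have hDB : ∀ {b d : X → V}, CnOn V 1 b W → CnOn V 1 d W → CnOn V 1 (fun z => D B (b z) (d z)) W :=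
    fun hb hd => (hB.of_le (m := 2) (by norm_num)).D_comp hb hd isOpen_univ hW fun _ _ => mem_univ _
  have hDDB : ∀ {b d e : X → V}, CnOn V 1 b W → CnOn V 1 d W → CnOn V 1 e W →
      CnOn V 1 (fun z => D2 B (b z) (d z) (e z)) W :=
    fun hb hd he => hB.D2_comp hb hd he isOpen_univ hW fun _ _ => mem_univ _
  have hv := hE (ht.half hW) (cnOn_const u W)
  have hw := hEB1.cnOn_comp ht hv hW hmt
  have hx := hE (hτ.half hW) hw
  have hy := hEB1.cnOn_comp hτ hv hW hmτ
  have hpt := hEB2.cnOn_D ht hv (hA hv) hW hmt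
  have hpτ := hEB2.cnOn_D hτ hv (hA hv) hW hmτ
  have hdt := hE (hτ.half hW) (hpt.sub (hA hw) hW)
  have hdτ := hpτ.sub (hA hy) hW
  have hδ := (hE (hτ.half hW) (hBc hw)).sub (hBc hx) hW
  have hs := (ht.sub hτ hW).half hW
  simp only [s2, comm_clm_comm_left hB, comm_clm_comm_right hB, comm_comm_right hB, commD]
  refine (((?_ : CnOn V 1 _ W).add ?_ hW).add ?_ hW).add ?_ hW
  · exact ((hE hs (hDDB hx (hA hx) hdt)).const_smul hW _).neg hW
  · refine (hE hs (CnOn.add ?_ ?_ hW)).const_smul hW _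
    · exact ((((hA (hDB hx (hA hx))).const_smul hW _).sub (hA (hA (hBc hx))) hW).sub
        (hDDB hx (hA hx) (hA hx)) hW).sub (hDB hx (hA (hA hx))) hW
    · exact (hA (hDB hx hdt)).sub (hDB hx (hA hdt)) hW
  · refine hE hs (CnOn.add (CnOn.add ?_ ?_ hW) ?_ hW)
    · exact (hDDB hx hδ (hA hx)).neg hW
    · refine CnOn.const_smul ?_ hW _
      exact (((hDB hx (hDB hx (hA hx))).sub ((hDB hx (hA (hBc hx))).const_smul hW _) hW).sub
        (hDDB hx (hA hx) (hBc hx)) hW).add (hA (hDB hx (hBc hx))) hW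
    · exact (hA (hDB hx hδ)).sub (hDB hx (hA hδ)) hW
  · refine hE (ht.half hW) (hEB2.cnOn_D (ht.sub hτ hW) hy (CnOn.add (CnOn.sub ?_ ?_ hW) ?_ hW) hW
      fun z hz => flow_mem_sub hEB (hmt z hz) (hmτ z hz))
    · refine CnOn.const_smul ?_ hW _
      exact (((hA (hA (hBc hy))).sub ((hA (hDB hy (hA hy))).const_smul hW _) hW).add
        (hDDB hy (hA hy) (hA hy)) hW).add (hDB hy (hA (hA hy))) hW
    · exact ((hA (hDB hy hdτ)).sub (hDB hy (hA hdτ)) hW).const_smul hW _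
    · exact (hDDB hy hdτ (hpτ.add (hA hy) hW)).const_smul hW _

end Defects

/-! ### Linearized flows along orbits and at time zero. -/

section FlowTime

variable {V : Type*} [AddCommGroup V] [Module ℝ V] [TopologicalSpace V]
  [IsTopologicalAddGroup V] [ContinuousSMul ℝ V] [T2Space V] [LocallyConvexSpace ℝ V]
variable {n : ℕ} {G : V → V} {Dom : Set (ℝ × V)} {E : ℝ → V → V} {s t : ℝ} {x h k : V}

theorem CnOn.D2_sub_left {U : Set V} (hG : CnOn V (n + 2) G U) (hU : IsOpen U) (hx : x ∈ U)
    (h h' k : V) : D2 G x (h - h') k = D2 G x h k - D2 G x h' k := by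
  rw [hG.D2_symm hU hx, hG.D2_symm hU hx h, hG.D2_symm hU hx h']
  exact (hG.D_apply hU k).D_sub hU hx h h'

theorem CnOn.D2_zero_right {U : Set V} (hG : CnOn V (n + 2) G U) (hU : IsOpen U) (hx : x ∈ U)
    (h : V) : D2 G x h 0 = 0 :=
  (hG.D_apply hU h).D_zero hU hx

namespace IsFlow

theorem hasDerivAt_D_time (hE : IsFlow (n + 2) G Dom E) (hG : CnOn V (n + 1) G univ)
    (hm : (s, x) ∈ Dom) (h : V) :
    HasDerivAt (fun s => D (E s) x h) (D G (E s x) (D (E s) x h)) s := by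
  have := hE.hasDerivAt_D_comp hG (hasDerivAt_id s) (hasDerivAt_const_tvs x s)
    (hasDerivAt_const_tvs h s) hm
  simp only [id] at this
  rw [(hE.cnOn_slice s).D2_zero_right (hE.isOpen_slice s) hm,
    (hE.cnOn_slice s).D_zero (hE.isOpen_slice s) hm] at this
  simpa using this

/-- Along an orbit the base point moves with velocity `G`, so the second-derivative term of
`hasDerivAt_D_sub` drops out. -/
theorem hasDerivAt_D_sub_flow (hE : IsFlow (n + 2) G Dom E) (hG : CnOn V (n + 1) G univ) {r : ℝ}
    {d : ℝ → V} {d' : V} (hd : HasDerivAt d d' r) (hr : (r, x) ∈ Dom) (hm : (t - r, E r x) ∈ Dom) :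
    HasDerivAt (fun r => D (E (t - r)) (E r x) (d r))
      (D (E (t - r)) (E r x) (d' - D G (E r x) (d r))) r := by
  have := hE.hasDerivAt_D_sub hG (hE.ode r x hr) hd hm
  rwa [sub_self, (hE.cnOn_slice _).D2_zero_right (hE.isOpen_slice _) hm, add_zero] at this

theorem D_at_zero (hE : IsFlow n G Dom E) (x h : V) : D (E 0) x h = h := by
  have h0 : E 0 = fun x => ContinuousLinearMap.id ℝ V x := funext hE.zero
  rw [h0, D_clm, ContinuousLinearMap.id_apply]

theorem D2_at_zero (hE : IsFlow n G Dom E) (x h k : V) : D2 (E 0) x h k = 0 := by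
  have : (fun y => D (E 0) y h) = fun _ => h := funext fun y => hE.D_at_zero y h
  rw [D2, this]
  exact D_eq_of_hasDerivAt (hasDerivAt_const_tvs h 0)

theorem mem_of_mem_Icc (hE : IsFlow n G Dom E) (ht : (t, x) ∈ Dom) (hs : s ∈ Icc 0 t) :
    (s, x) ∈ Dom :=
  (hE.interval x).out (hE.zero_mem x) ht hs

end IsFlow

end FlowTime

/-! ### Integral representations of the two defects. -/

section Representation

variable {V : Type*} [AddCommGroup V] [Module ℝ V] [TopologicalSpace V]
  [IsTopologicalAddGroup V] [ContinuousSMul ℝ V] [T2Space V] [LocallyConvexSpace ℝ V]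
variable {A : V →L[ℝ] V} {B : V → V} {EA : ℝ → V →L[ℝ] V} {EB : ℝ → V → V}
  {DomB : Set (ℝ × V)} {u : V} {t τ : ℝ}
variable (hB : CnOn V 3 B univ) (hEA : IsFlow 3 (fun x => A x) univ (fun t x => EA t x))
  (hEB : IsFlow 3 B DomB EB)

theorem hasDerivAt_sub_half (t τ : ℝ) : HasDerivAt (fun τ : ℝ => (t - τ) / 2) (-(1 / 2)) τ := by
  rw [← neg_div]
  exact ((hasDerivAt_id τ).const_sub t).div_const 2

include hB hEA hEB in
-- The first term of the primitive interpolates between `E_A(t/2) B(w)` and `B(S)`, the second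
-- between `∂₂E_B(t,v) A v` and `A w`: these are the differences in `S1_eq`.
theorem hasDerivAt_s1 (hτ : (τ, EA (t / 2) u) ∈ DomB) (ht : (t, EA (t / 2) u) ∈ DomB) :
    HasDerivAt (fun τ => -EA ((t - τ) / 2) (B (EA (τ / 2) (inner EA EB u t)))
      - (1 / 2 : ℝ) • EA (t / 2) (D (EB (t - τ)) (EB τ (EA (t / 2) u)) (A (EB τ (EA (t / 2) u)))))
      (s1 A B EA EB t τ u) τ := by
  have hx := hasDerivAt_half hEA (inner EA EB u t) τ
  have h1 := (hasDerivAt_group hEA (hasDerivAt_sub_half t τ)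
    (hB.hasDerivAt_comp isOpen_univ hx (mem_univ _))).tvs_neg
  have hy := hEB.ode τ _ hτ
  have hm := flow_mem_sub hEB ht hτ
  have h2 := ((hEB.hasDerivAt_D_sub_flow (hB.of_le (by norm_num)) (hy.tvs_comp_clm A) hτ
    hm).tvs_comp_clm (EA (t / 2))).tvs_const_smul (1 / 2 : ℝ)
  convert h1.tvs_sub h2 using 1
  obtain ⟨L, hL⟩ := (hEB.cnOn_slice (t - τ)).exists_clm (hEB.isOpen_slice _) hm
  simp only [s1, comm_clm_left hB, comm_clm_right hB, hB.D_smul (mem_univ _), ← hL, map_sub,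
    map_add, map_smul, inner]
  module

include hB hEA hEB in
theorem isIntegral_s1 (ht0 : 0 ≤ t) (ht : (t, EA (t / 2) u) ∈ DomB) :
    IsIntegral (fun τ => s1 A B EA EB t τ u) 0 t (S1 A B EA EB t u) := by
  have hmem : ∀ τ ∈ Icc 0 t, (τ, EA (t / 2) u) ∈ DomB := fun τ hτ => hEB.mem_of_mem_Icc ht hτ
  have hW : IsOpen {τ : ℝ | (τ, EA (t / 2) u) ∈ DomB} :=
    hEB.isOpen.preimage (by fun_prop : Continuous fun τ : ℝ => (τ, EA (t / 2) u))
  have hc := (cnOn_s1 hB hEA hEB hW (cnOn_const t _) (cnOn_clm (ContinuousLinearMap.id ℝ ℝ) _)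
    (fun _ _ => ht) (fun _ hz => hz)).continuousOn
  have key := IsIntegral.of_hasDerivAt ht0
    (fun τ hτ => hasDerivAt_s1 hB hEA hEB (hmem τ hτ) ht) (hc.mono hmem)
  convert key using 1
  rw [S1_eq hEA hEB ht]
  have hz : ∀ x, EA 0 x = x := hEA.zero
  simp only [sub_self, sub_zero, zero_div, hz, hEB.D_at_zero, hEB.zero, step, innerD, inner,
    map_sub]
  module

include hB hEA in
-- With `w` and `d` frozen, this is the primitive for the terms of `s2` propagated by
-- `E_A((t-τ)/2)`.
theorem hasDerivAt_s2_left (t τ : ℝ) (w d x : V) (hx : x = EA (τ / 2) w) :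
    HasDerivAt (fun τ => EA ((t - τ) / 2) (D B (EA (τ / 2) w)
        (B (EA (τ / 2) w) - A (EA (τ / 2) w) - EA (τ / 2) d - (2 : ℝ) • EA (τ / 2) (B w))
        + A (B (EA (τ / 2) w))))
      (-((1 / 2 : ℝ) • EA ((t - τ) / 2) (D2 B x (A x) (EA (τ / 2) d)))
        + (1 / 2 : ℝ) • EA ((t - τ) / 2) (comm A (comm B A) x + commD A B x (EA (τ / 2) d))
        + EA ((t - τ) / 2) (-(D2 B x (EA (τ / 2) (B w) - B x) (A x))
          + (1 / 2 : ℝ) • comm B (comm B A) x + commD A B x (EA (τ / 2) (B w) - B x))) τ := by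
  have hw := hasDerivAt_half hEA w τ
  have hBx := hB.hasDerivAt_comp isOpen_univ hw (mem_univ _)
  have h1 := hB.hasDerivAt_D_comp isOpen_univ hw
    (((hBx.tvs_sub (hw.tvs_comp_clm A)).tvs_sub (hasDerivAt_half hEA d τ)).tvs_sub
      ((hasDerivAt_half hEA (B w) τ).tvs_const_smul 2)) (mem_univ _)
  have h2 := hasDerivAt_group hEA (hasDerivAt_sub_half t τ) (h1.tvs_add (hBx.tvs_comp_clm A))
  convert h2 using 1
  rw [← hx]
  obtain ⟨L, hL⟩ := hB.exists_clm isOpen_univ (mem_univ x)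
  obtain ⟨M, hM⟩ := hB.exists_clm_D2 isOpen_univ (mem_univ x) (A x)
  -- Symmetry moves `A x` into the first slot, leaving a linear expression in `h`.
  have hs : ∀ h (c : ℝ), D2 B x h (c • A x) = c • M h := fun h c => by
    obtain ⟨N, hN⟩ := hB.exists_clm_D2 isOpen_univ (mem_univ x) h
    rw [← hN, map_smul, hN, hB.D2_symm isOpen_univ (mem_univ x), hM]
  have hs' : ∀ h, D2 B x h (A x) = M h := fun h => by simpa using hs h 1
  simp only [comm_clm_comm_right hB, comm_comm_right hB, commD, hs, hs', ← hL, ← hM, map_sub,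
    map_add, map_smul, map_neg]
  module

include hB hEB in
-- Variation of constants for `E_B`: the transported vector is built from solutions of the orbit
-- equation and of the two variational equations, and its failure to solve the linearized equation
-- produces the commutators.
theorem hasDerivAt_s2_right {v p y : V} (hτ : (τ, v) ∈ DomB) (ht : (t, v) ∈ DomB)
    (hp : p = D (EB τ) v (A v)) (hy : y = EB τ v) :
    HasDerivAt (fun τ => D (EB (t - τ)) (EB τ v) (-((1 / 2 : ℝ) • A (D (EB τ) v (A v)))
        + (1 / 4 : ℝ) • A (A (EB τ v)) + (1 / 4 : ℝ) • D2 (EB τ) v (A v) (A v)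
        + (1 / 4 : ℝ) • D (EB τ) v (A (A v))))
      (D (EB (t - τ)) y ((1 / 4 : ℝ) • comm A (comm A B) y - (1 / 2 : ℝ) • commD A B y (p - A y)
          + (1 / 4 : ℝ) • D2 B y (p - A y) (p + A y))) τ := by
  have hm := flow_mem_sub hEB ht hτ
  have hB2 := hB.of_le (m := 2) (by norm_num)
  have hp' := hEB.hasDerivAt_D_time hB2 hτ (A v)
  have hz := ((((hp'.tvs_comp_clm A).tvs_const_smul (1 / 2 : ℝ)).tvs_neg.tvs_add
    ((((hEB.ode τ v hτ).tvs_comp_clm A).tvs_comp_clm A).tvs_const_smul (1 / 4 : ℝ))).tvs_add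
    ((hEB.hasDerivAt_D2 hB2 hτ (A v) (A v)).tvs_const_smul (1 / 4 : ℝ))).tvs_add
    ((hEB.hasDerivAt_D_time hB2 hτ (A (A v))).tvs_const_smul (1 / 4 : ℝ))
  have h1 := hEB.hasDerivAt_D_sub_flow hB2 hz hτ hm
  convert h1 using 1
  rw [← hp, ← hy]
  congr 1
  obtain ⟨L, hL⟩ := hB.exists_clm isOpen_univ (mem_univ y)
  obtain ⟨M, hM⟩ := hB.exists_clm_D2 isOpen_univ (mem_univ y) p
  obtain ⟨N, hN⟩ := hB.exists_clm_D2 isOpen_univ (mem_univ y) (A y)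
  -- The mixed terms of `B''(y)(p - A y, p + A y)` cancel, leaving the difference of the two
  -- squares.
  have hs : M (A y) = N p := by rw [hM, hN, hB.D2_symm isOpen_univ (mem_univ y)]
  simp only [comm_clm_comm_left hB, commD, hB.D2_sub_left isOpen_univ (mem_univ y), ← hL, ← hM,
    ← hN, map_sub, map_add, map_smul, map_neg, hs]
  module

include hB hEA hEB in
theorem isIntegral_s2 (ht0 : 0 ≤ t) (ht : (t, EA (t / 2) u) ∈ DomB) :
    IsIntegral (fun τ => s2 A B EA EB t τ u) 0 t (S2 A B EA EB t u) := by
  have hmem : ∀ τ ∈ Icc 0 t, (τ, EA (t / 2) u) ∈ DomB := fun τ hτ => hEB.mem_of_mem_Icc ht hτ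
  have hW : IsOpen {τ : ℝ | (τ, EA (t / 2) u) ∈ DomB} :=
    hEB.isOpen.preimage (by fun_prop : Continuous fun τ : ℝ => (τ, EA (t / 2) u))
  have hc := (cnOn_s2 hB hEA hEB hW (cnOn_const t _) (cnOn_clm (ContinuousLinearMap.id ℝ ℝ) _)
    (fun _ _ => ht) (fun _ hz => hz)).continuousOn
  have key := IsIntegral.of_hasDerivAt ht0 (f' := fun τ => s2 A B EA EB t τ u)
    (fun τ hτ => (hasDerivAt_s2_left hB hEA t τ (inner EA EB u t)
      (innerD A EA EB u t - A (inner EA EB u t)) _ rfl).tvs_add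
      ((hasDerivAt_s2_right (A := A) hB hEB (hmem τ hτ) ht rfl rfl).tvs_comp_clm (EA (t / 2))))
    (hc.mono hmem)
  convert key using 1
  rw [S2_eq hB hEA hEB ht]
  have hz : ∀ x, EA 0 x = x := hEA.zero
  -- The right primitive vanishes at `τ = 0`, since `-1/2 + 1/4 + 1/4 = 0` and the second derivative
  -- of `EB 0` is zero.
  have h0 : -((1 / 2 : ℝ) • A (A (EA (t / 2) u))) + (1 / 4 : ℝ) • A (A (EA (t / 2) u))
      + (1 / 4 : ℝ) • (0 : V) + (1 / 4 : ℝ) • A (A (EA (t / 2) u)) = 0 := by module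
  simp only [sub_self, sub_zero, zero_div, hz, hEB.D_at_zero, hEB.D2_at_zero, hEB.zero, h0,
    (hEB.cnOn_slice t).D_zero (hEB.isOpen_slice t) ht, map_zero, add_zero]
  have h1 : step EA EB t u = EA (t / 2) (inner EA EB u t) := rfl
  have h2 : D (EB t) (EA (t / 2) u) (A (EA (t / 2) u)) = innerD A EA EB u t := rfl
  have h3 : EB t (EA (t / 2) u) = inner EA EB u t := rfl
  rw [← h1, h2, h3]
  obtain ⟨L, hL⟩ := hB.exists_clm isOpen_univ (mem_univ (inner EA EB u t))
  obtain ⟨M, hM⟩ := hB.exists_clm isOpen_univ (mem_univ (step EA EB t u))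
  simp only [← hL, ← hM, map_sub, map_add, map_smul, map_neg]
  module

end Representation

/-! ### The local error: double integral and estimates. -/

section LocalError

variable {V : Type*} [AddCommGroup V] [Module ℝ V] [TopologicalSpace V]
  [IsTopologicalAddGroup V] [ContinuousSMul ℝ V] [T2Space V] [LocallyConvexSpace ℝ V]
variable {X : Type*} [AddCommGroup X] [Module ℝ X] [TopologicalSpace X]
  [IsTopologicalAddGroup X] [ContinuousSMul ℝ X]
variable {A : V →L[ℝ] V} {B : V → V} {EA : ℝ → V →L[ℝ] V} {EB EF : ℝ → V → V}
  {DomB DomF : Set (ℝ × V)} {u : V} {t τ : ℝ}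
variable (hB : CnOn V 3 B univ) (hEA : IsFlow 3 (fun x => A x) univ (fun t x => EA t x))
  (hEB : IsFlow 3 B DomB EB) (hEF : IsFlow 2 (field A B) DomF EF)

theorem cnOn_field {n : ℕ} (hB : CnOn V n B univ) : CnOn V n (field A B) univ :=
  (cnOn_clm A univ).add hB isOpen_univ

theorem CnOn.D2_smul_smul {n : ℕ} {G : V → V} {U : Set V} (hG : CnOn V (n + 2) G U)
    (hU : IsOpen U) {x : V} (hx : x ∈ U) (c : ℝ) (h : V) :
    D2 G x (c • h) (c • h) = c ^ 2 • D2 G x h h := by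
  have h1 : ∀ y, D2 G x y (c • h) = c • D2 G x y h := fun y =>
    (hG.D_apply hU y).D_smul hx c h
  rw [h1, hG.D2_symm hU hx, h1, smul_smul, pow_two]

include hEA hEB in
theorem cnOn_step (u : V) :
    CnOn V 1 (fun t => step EA EB t u) {t : ℝ | (t, EA (t / 2) u) ∈ DomB} := by
  have hW := isOpen_times hEA hEB u
  have ht : CnOn ℝ 1 (fun t : ℝ => t) {t : ℝ | (t, EA (t / 2) u) ∈ DomB} :=
    cnOn_clm (ContinuousLinearMap.id ℝ ℝ) _
  have hEA1 := hEA.of_le (m := 1) (by norm_num)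
  exact hEA1.cnOn_comp (ht.half hW) ((hEB.of_le (m := 1) (by norm_num)).cnOn_comp ht
    (hEA1.cnOn_comp (ht.half hW) (cnOn_const u _) hW fun _ _ => mem_univ _) hW fun _ hz => hz) hW
    fun _ _ => mem_univ _

include hEA hEB in
theorem step_zero (u : V) : step EA EB 0 u = u := by
  have hz : ∀ x, EA 0 x = x := hEA.zero
  simp only [step, zero_div, hz, hEB.zero]

include hEA hEB in
theorem zero_mem_times (u : V) : ((0 : ℝ), EA (0 / 2) u) ∈ DomB := hEB.zero_mem _

include hEA hEB in
theorem S1_zero (u : V) : S1 A B EA EB 0 u = 0 := by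
  have hz : ∀ x, EA 0 x = x := hEA.zero
  rw [S1_eq hEA hEB (zero_mem_times hEA hEB u), step_zero hEA hEB]
  simp only [inner, innerD, zero_div, hz, hEB.zero, hEB.D_at_zero, sub_self, smul_zero, add_zero]

include hB hEA hEB in
-- At time zero the flows are identities and `d_t`, `d_τ` and `E_A B(w) - B(x)` vanish. Of the
-- `A`-commutators, `1/2 [A,[B,A]] + 1/4 [A,[A,B]]` leaves the coefficient `1/4`.
theorem s2_zero (u : V) : s2 A B EA EB 0 0 u = leading A B u := by
  have hz : ∀ x, EA 0 x = x := hEA.zero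
  obtain ⟨L, hL⟩ := hB.exists_clm isOpen_univ (mem_univ u)
  simp only [s2, leading, zero_div, sub_self, hz, hEB.zero, hEB.D_at_zero,
    hB.D2_zero_right isOpen_univ (mem_univ u), commD, hB.D2_symm isOpen_univ (mem_univ u) 0,
    ← hL, map_zero, comm_clm_comm_left hB, comm_clm_comm_right hB]
  module

include hEA hEB in
theorem hasDerivAt_step_field (ht : (t, EA (t / 2) u) ∈ DomB) :
    HasDerivAt (fun t => step EA EB t u)
      (field A B (step EA EB t u) + S1 A B EA EB t u) t := by
  have h1 := hasDerivAt_step hEA hEB ht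
  rw [S1, add_sub_cancel, h1.tvs_deriv]
  exact h1

include hB hEA hEB in
theorem hasDerivAt_S1_field (ht : (t, EA (t / 2) u) ∈ DomB) :
    HasDerivAt (fun t => S1 A B EA EB t u)
      (S2 A B EA EB t u + D (field A B) (step EA EB t u) (S1 A B EA EB t u)) t := by
  have h1 := hasDerivAt_S1 hB hEA hEB ht
  rw [S2, sub_add_cancel, h1.tvs_deriv]
  exact h1

include hEA hEB hEF in
-- The field part of `∂_τ S` is transported to `F(E_F)` and cancels the backward time derivative;
-- only the defect survives.
theorem hasDerivAt_localError (hτ : (τ, EA (τ / 2) u) ∈ DomB)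
    (hm : (t - τ, step EA EB τ u) ∈ DomF) :
    HasDerivAt (fun τ => EF (t - τ) (step EA EB τ u))
      (D (EF (t - τ)) (step EA EB τ u) (S1 A B EA EB τ u)) τ := by
  have h1 := hEF.hasDerivAt_comp ((hasDerivAt_id τ).const_sub t)
    (hasDerivAt_step_field (A := A) hEA hEB hτ) hm
  simp only [id] at h1
  rw [(hEF.cnOn_slice _).D_add (hEF.isOpen_slice _) hm, hEF.D_field hm] at h1
  convert h1 using 1
  module

include hB hEA hEB hEF in
-- In `hasDerivAt_D_sub` the two differences `b' - G(b)` and `d' - G'(b) d` are by definition `S⁽¹⁾`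
-- and `S⁽²⁾`.
theorem hasDerivAt_localError_defect (hτ : (τ, EA (τ / 2) u) ∈ DomB)
    (hm : (t - τ, step EA EB τ u) ∈ DomF) :
    HasDerivAt (fun τ => D (EF (t - τ)) (step EA EB τ u) (S1 A B EA EB τ u))
      (D (EF (t - τ)) (step EA EB τ u) (S2 A B EA EB τ u)
        + D2 (EF (t - τ)) (step EA EB τ u) (S1 A B EA EB τ u) (S1 A B EA EB τ u)) τ := by
  have h1 := hEF.hasDerivAt_D_sub (cnOn_field (hB.of_le (m := 1) (by norm_num)))
    (hasDerivAt_step_field (A := A) hEA hEB hτ) (hasDerivAt_S1_field hB hEA hEB hτ) hm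
  rwa [add_sub_cancel_right, add_sub_cancel_left] at h1

include hEA hEB hEF in
/-- The set of `(t, τ)` where the backward flow of the splitting solution is defined is open. -/
theorem isOpen_pairs (u : V) : IsOpen {q : ℝ × ℝ | (q.2, EA (q.2 / 2) u) ∈ DomB ∧
    (q.1 - q.2, step EA EB q.2 u) ∈ DomF} := by
  have h1 : IsOpen {q : ℝ × ℝ | (q.2, EA (q.2 / 2) u) ∈ DomB} :=
    (isOpen_times hEA hEB u).preimage continuous_snd
  have h2 : ContinuousOn (fun q : ℝ × ℝ => (q.1 - q.2, step EA EB q.2 u))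
      {q : ℝ × ℝ | (q.2, EA (q.2 / 2) u) ∈ DomB} :=
    (by fun_prop : Continuous fun q : ℝ × ℝ => q.1 - q.2).continuousOn.prodMk
      ((cnOn_step hEA hEB u).continuousOn.comp continuous_snd.continuousOn fun q hq => hq)
  exact h2.isOpen_inter_preimage h1 hEF.isOpen

include hEA hEB in
theorem isOpen_inner_pairs (u : V) : IsOpen {q : ℝ × ℝ | (q.1, EA (q.1 / 2) u) ∈ DomB ∧
    (q.2, EA (q.1 / 2) u) ∈ DomB} := by
  have h : Continuous fun t : ℝ => EA (t / 2) u :=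
    continuous_iff_continuousAt.2 fun t => (hasDerivAt_half hEA u t).tvs_continuousAt
  have h' : Continuous fun q : ℝ × ℝ => EA (q.1 / 2) u := h.comp continuous_fst
  exact (hEB.isOpen.preimage (continuous_fst.prodMk h')).inter
    (hEB.isOpen.preimage (continuous_snd.prodMk h'))

theorem isCompact_triangle (T : ℝ) : IsCompact {q : ℝ × ℝ | q.1 ∈ Icc 0 T ∧ q.2 ∈ Icc 0 q.1} := by
  refine (isCompact_Icc.prod isCompact_Icc :
    IsCompact (Icc (0 : ℝ) T ×ˢ Icc (0 : ℝ) T)).of_isClosed_subset ?_ ?_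
  · simp only [mem_Icc, ofPred_and]
    refine IsClosed.inter (IsClosed.inter ?_ ?_) (IsClosed.inter ?_ ?_) <;>
    exact isClosed_le (by fun_prop) (by fun_prop)
  · rintro ⟨t, τ⟩ ⟨h1, h2⟩
    exact ⟨h1, h2.1, h2.2.trans h1.2⟩

theorem isCompact_simplex (T : ℝ) :
    IsCompact {q : ℝ × ℝ × ℝ | q.1 ∈ Icc 0 T ∧ q.2.1 ∈ Icc 0 q.1 ∧ q.2.2 ∈ Icc 0 q.2.1} := by
  refine (isCompact_Icc.prod (isCompact_Icc.prod isCompact_Icc) :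
    IsCompact (Icc (0 : ℝ) T ×ˢ Icc (0 : ℝ) T ×ˢ Icc (0 : ℝ) T)).of_isClosed_subset ?_ ?_
  · simp only [mem_Icc, ofPred_and]
    refine IsClosed.inter (IsClosed.inter ?_ ?_) (IsClosed.inter (IsClosed.inter ?_ ?_)
      (IsClosed.inter ?_ ?_)) <;>
    exact isClosed_le (by fun_prop) (by fun_prop)
  · rintro ⟨t, τ, σ⟩ ⟨h1, h2, h3⟩
    exact ⟨h1, ⟨h2.1, h2.2.trans h1.2⟩, h3.1, h3.2.trans (h2.2.trans h1.2)⟩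

theorem mul_mem_Icc {r c : ℝ} (hr : r ∈ Icc (0 : ℝ) 1) (ht : t ∈ Icc 0 c) : r * t ∈ Icc 0 c :=
  ⟨mul_nonneg hr.1 ht.1, (mul_le_of_le_one_left ht.1 hr.2).trans ht.2⟩

theorem mul_mem_Icc_mul {r c : ℝ} (hr : r ∈ Icc (0 : ℝ) 1) (ht : t ∈ Icc 0 c) :
    r * t ∈ Icc 0 (r * c) :=
  ⟨mul_nonneg hr.1 ht.1, mul_le_mul_of_nonneg_left ht.2 hr.1⟩

variable {T : ℝ} (hTB : ∀ t ∈ Icc 0 T, (t, EA (t / 2) u) ∈ DomB)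
  (hTF : ∀ t ∈ Icc 0 T, ∀ τ ∈ Icc 0 t, (t - τ, step EA EB τ u) ∈ DomF)
  {p : Seminorm ℝ V} (hp : Continuous p)

include hB hEA hEB hTB hp in
theorem exists_seminorm_S1_le : ∃ C : ℝ, 0 ≤ C ∧ ∀ t ∈ Icc 0 T, p (S1 A B EA EB t u) ≤ C * t := by
  obtain ⟨C, hC0, hC⟩ := (cnOn_S1 hB hEA hEB u).exists_seminorm_sub_le (isCompact_Icc (a := 0)
    (b := T)) hTB (isCompact_singleton (x := 1)) hp
  refine ⟨C, hC0, fun t ht => ?_⟩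
  have := hC 1 rfl t ht.1 fun r hr => by simpa using mul_mem_Icc hr ht
  simpa [S1_zero hEA hEB] using this

include hB hEA hEB hTB hp in
theorem exists_seminorm_s2_sub_le : ∃ C : ℝ, 0 ≤ C ∧ ∀ t ∈ Icc 0 T, ∀ τ ∈ Icc 0 t,
    p (s2 A B EA EB t τ u - leading A B u) ≤ C * t := by
  have hf := cnOn_s2 hB hEA hEB (u := u) (isOpen_inner_pairs hEA hEB u)
    (cnOn_clm (ContinuousLinearMap.fst ℝ ℝ ℝ) _) (cnOn_clm (ContinuousLinearMap.snd ℝ ℝ ℝ) _)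
    (fun z hz => hz.1) (fun z hz => hz.2)
  obtain ⟨C, hC0, hC⟩ := hf.exists_seminorm_sub_le (isCompact_triangle T)
    (fun q hq => ⟨hTB _ hq.1, hEB.mem_of_mem_Icc (hTB _ hq.1) hq.2⟩)
    ((isCompact_singleton (x := (1 : ℝ))).prod (isCompact_Icc (a := (0 : ℝ)) (b := 1))) hp
  refine ⟨C, hC0, fun t ht τ hτ => ?_⟩
  rw [← s2_zero hB hEA hEB]
  rcases ht.1.eq_or_lt with rfl | h
  · have : τ = 0 := le_antisymm hτ.2 hτ.1
    simp [this]
  -- The point `(t, τ)` lies on the ray through `(1, τ/t)`, whose direction ranges over a compact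
  -- set and whose initial segment stays in the triangle.
  · have := hC (1, τ / t) ⟨rfl, div_nonneg hτ.1 h.le, (div_le_one h).2 hτ.2⟩ t h.le fun r hr => by
      have h1 : r * t * (τ / t) = r * τ := by field_simp
      simp only [Prod.smul_mk, smul_eq_mul, mul_one, h1]
      exact ⟨mul_mem_Icc hr ht, mul_mem_Icc_mul hr hτ⟩
    have h2 : t * (τ / t) = τ := by field_simp
    simpa [h2] using this

include hB hEA hEB hEF hTB hTF hp in
-- The linear map `∂₂E_F` passes under the integral for `S⁽²⁾`, so the quantity is the integral over
-- `σ ∈ [0, τ]` of a `C¹` function of `(t, τ, σ)` minus its value `ℓ(u)` at the origin.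
theorem exists_seminorm_D_S2_sub_le : ∃ C : ℝ, 0 ≤ C ∧ ∀ t ∈ Icc 0 T, ∀ τ ∈ Icc 0 t,
    p (D (EF (t - τ)) (step EA EB τ u) (S2 A B EA EB τ u) - τ • leading A B u) ≤ C * t * τ := by
  let W : Set (ℝ × ℝ × ℝ) := {q | ((q.1, q.2.1) : ℝ × ℝ) ∈ {q : ℝ × ℝ |
    (q.2, EA (q.2 / 2) u) ∈ DomB ∧ (q.1 - q.2, step EA EB q.2 u) ∈ DomF}} ∩
    {q | q.2 ∈ {q : ℝ × ℝ | (q.1, EA (q.1 / 2) u) ∈ DomB ∧ (q.2, EA (q.1 / 2) u) ∈ DomB}}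
  have hW : IsOpen W := ((isOpen_pairs hEA hEB hEF u).preimage
    (by fun_prop : Continuous fun q : ℝ × ℝ × ℝ => (q.1, q.2.1))).inter
    ((isOpen_inner_pairs hEA hEB u).preimage continuous_snd)
  have ht : CnOn ℝ 1 (fun q : ℝ × ℝ × ℝ => q.1) W :=
    cnOn_clm (ContinuousLinearMap.fst ℝ ℝ (ℝ × ℝ)) _
  have hτ : CnOn ℝ 1 (fun q : ℝ × ℝ × ℝ => q.2.1) W :=
    cnOn_clm ((ContinuousLinearMap.fst ℝ ℝ ℝ).comp (ContinuousLinearMap.snd ℝ ℝ (ℝ × ℝ))) _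
  have hσ : CnOn ℝ 1 (fun q : ℝ × ℝ × ℝ => q.2.2) W :=
    cnOn_clm ((ContinuousLinearMap.snd ℝ ℝ ℝ).comp (ContinuousLinearMap.snd ℝ ℝ (ℝ × ℝ))) _
  have hf := hEF.cnOn_D (ht.sub hτ hW)
    ((cnOn_step hEA hEB u).comp hτ (isOpen_times hEA hEB u) hW fun q hq => hq.2.1)
    (cnOn_s2 hB hEA hEB (u := u) hW hτ hσ (fun z hz => hz.2.1) (fun z hz => hz.2.2)) hW
    (fun z hz => hz.1.2)
  obtain ⟨C, hC0, hC⟩ := hf.exists_seminorm_sub_le (isCompact_simplex T)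
    (fun q hq => by
      have h1 := hTB q.2.1 ⟨hq.2.1.1, hq.2.1.2.trans hq.1.2⟩
      exact ⟨⟨h1, hTF _ hq.1 _ hq.2.1⟩, h1, hEB.mem_of_mem_Icc h1 hq.2.2⟩)
    ((isCompact_singleton (x := (1 : ℝ))).prod ((isCompact_Icc (a := (0 : ℝ)) (b := 1)).prod
      (isCompact_Icc (a := (0 : ℝ)) (b := 1)))) hp
  have hf0 : D (EF ((0 : ℝ) - 0)) (step EA EB 0 u) (s2 A B EA EB 0 0 u) = leading A B u := by
    rw [sub_zero, hEF.D_at_zero, s2_zero hB hEA hEB]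
  simp only [Prod.fst_zero, Prod.snd_zero, hf0] at hC
  refine ⟨C, hC0, fun t ht τ hτ => ?_⟩
  have hbound : ∀ σ ∈ Icc 0 τ, p (D (EF (t - τ)) (step EA EB τ u) (s2 A B EA EB τ σ u)
      - leading A B u) ≤ C * t := by
    intro σ hσ
    rcases ht.1.eq_or_lt with rfl | h
    · have h1 : τ = 0 := le_antisymm hτ.2 hτ.1
      subst h1
      have h2 : σ = 0 := le_antisymm hσ.2 hσ.1
      rw [h2, hf0]
      simp
    · have := hC (1, τ / t, σ / t) ⟨rfl, ⟨div_nonneg hτ.1 h.le, (div_le_one h).2 hτ.2⟩,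
        div_nonneg hσ.1 h.le, (div_le_one h).2 (hσ.2.trans hτ.2)⟩ t h.le fun r hr => by
          have h1 : r * t * (τ / t) = r * τ := by field_simp
          have h2 : r * t * (σ / t) = r * σ := by field_simp
          simp only [Prod.smul_mk, smul_eq_mul, mul_one, h1, h2]
          exact ⟨mul_mem_Icc hr ht, mul_mem_Icc_mul hr hτ, mul_mem_Icc_mul hr hσ⟩
      have h2 : t * (τ / t) = τ := by field_simp
      have h3 : t * (σ / t) = σ := by field_simp
      simpa [h2, h3] using this
  have hτB := hTB τ ⟨hτ.1, hτ.2.trans ht.2⟩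
  obtain ⟨L, hL⟩ := (hEF.cnOn_slice (t - τ)).exists_clm (hEF.isOpen_slice _) (hTF t ht τ hτ)
  simp only [← hL] at hbound ⊢
  have key := (((isIntegral_s2 hB hEA hEB hτ.1 hτB).clm L).sub
    (isIntegral_const (leading A B u) 0 τ)).seminorm_le hτ.1 hp hbound
  simpa using key

include hB hEA hEB hEF hTB hTF hp in
-- `E_F` is only `C²`, so its second derivative is merely continuous. Writing `S⁽¹⁾ = τ R(τ)` with
-- `R` continuous extracts `τ²` by bilinearity, and compactness bounds the rest.
theorem exists_seminorm_D2_S1_le : ∃ C : ℝ, 0 ≤ C ∧ ∀ t ∈ Icc 0 T, ∀ τ ∈ Icc 0 t,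
    p (D2 (EF (t - τ)) (step EA EB τ u) (S1 A B EA EB τ u) (S1 A B EA EB τ u)) ≤ C * τ ^ 2 := by
  have h0 := hasDerivAt_S1_field hB hEA hEB (zero_mem_times hEA hEB u)
  set d := S2 A B EA EB 0 u + D (field A B) (step EA EB 0 u) (S1 A B EA EB 0 u) with hd
  -- The value at `0` is the derivative of `S⁽¹⁾` there, which makes `R` continuous.
  let R : ℝ → V := fun τ => if τ = 0 then d else τ⁻¹ • S1 A B EA EB τ u
  have hR : ∀ τ, S1 A B EA EB τ u = τ • R τ := by
    intro τ
    by_cases h : τ = 0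
    · simp [h, S1_zero hEA hEB]
    · simp [R, h]
  have hΩ := isOpen_times hEA hEB u
  have hRc : ContinuousOn R {t : ℝ | (t, EA (t / 2) u) ∈ DomB} := by
    intro τ hτ
    refine ContinuousAt.continuousWithinAt ?_
    by_cases h : τ = 0
    · subst h
      have h1 := hasDerivAt_iff_tendsto_inv_smul.1 h0
      simp only [S1_zero hEA hEB, zero_add, sub_zero] at h1
      rw [continuousAt_iff_punctured_nhds]
      have h2 : R 0 = d := by simp [R]
      rw [h2]
      refine h1.congr' ?_
      filter_upwards [self_mem_nhdsWithin] with s hs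
      have : s ≠ 0 := hs
      simp [R, this]
    · have h1 : ContinuousAt (fun τ => S1 A B EA EB τ u) τ :=
        (cnOn_S1 hB hEA hEB u).continuousOn.continuousAt (hΩ.mem_nhds hτ)
      refine ((continuousAt_inv₀ h).smul h1).congr ?_
      filter_upwards [isOpen_ne.mem_nhds h] with s hs
      have : s ≠ 0 := hs
      simp [R, this]
  have hW := isOpen_pairs hEA hEB hEF u
  have hτ' : ContinuousOn (fun q : ℝ × ℝ => q.2) {q : ℝ × ℝ | (q.2, EA (q.2 / 2) u) ∈ DomB ∧
    (q.1 - q.2, step EA EB q.2 u) ∈ DomF} := continuous_snd.continuousOn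
  have hts : ContinuousOn (fun q : ℝ × ℝ => q.1 - q.2) {q : ℝ × ℝ | (q.2, EA (q.2 / 2) u) ∈ DomB ∧
    (q.1 - q.2, step EA EB q.2 u) ∈ DomF} :=
    (by fun_prop : Continuous fun q : ℝ × ℝ => q.1 - q.2).continuousOn
  have hRc' := hRc.comp hτ' fun q hq => hq.1
  have hc : ContinuousOn (fun q : ℝ × ℝ => D2 (EF (q.1 - q.2)) (step EA EB q.2 u) (R q.2) (R q.2))
      {q : ℝ × ℝ | (q.2, EA (q.2 / 2) u) ∈ DomB ∧ (q.1 - q.2, step EA EB q.2 u) ∈ DomF} :=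
    IsFlow.cnOn_D2 (n := 0) hEF hts
      ((cnOn_step hEA hEB u).continuousOn.comp hτ' fun q hq => hq.1) hRc' hRc' hW fun q hq => hq.2
  obtain ⟨C, hC⟩ := ((isCompact_triangle T).image_of_continuousOn (hp.comp_continuousOn (hc.mono
    fun q hq => ⟨hTB q.2 ⟨hq.2.1, hq.2.2.trans hq.1.2⟩, hTF _ hq.1 _ hq.2⟩))).bddAbove
  refine ⟨max C 0, le_max_right _ _, fun t ht τ hτ => ?_⟩
  rw [hR τ, (hEF.cnOn_slice (t - τ)).D2_smul_smul (hEF.isOpen_slice _) (hTF t ht τ hτ),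
    map_smul_eq_mul, Real.norm_of_nonneg (sq_nonneg τ), mul_comm]
  have h1 := hC (mem_image_of_mem _ (show (t, τ) ∈ _ from ⟨ht, hτ⟩))
  exact mul_le_mul_of_nonneg_right (h1.trans (le_max_left _ _)) (sq_nonneg τ)

include hB hEA hEB hEF hTB hTF in
-- Two applications of the fundamental theorem; the inner one has no boundary term at `0` because
-- `S⁽¹⁾(0,u) = 0`.
theorem isDoubleIntegral_localError (ht : t ∈ Icc 0 T) :
    IsDoubleIntegral
      (fun τ₂ => D (EF (t - τ₂)) (step EA EB τ₂ u) (S2 A B EA EB τ₂ u)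
        + D2 (EF (t - τ₂)) (step EA EB τ₂ u) (S1 A B EA EB τ₂ u) (S1 A B EA EB τ₂ u))
      t (localError EA EB EF t u) := by
  let W : Set ℝ := {τ | (t, τ) ∈ {q : ℝ × ℝ | (q.2, EA (q.2 / 2) u) ∈ DomB ∧
    (q.1 - q.2, step EA EB q.2 u) ∈ DomF}}
  have hW : IsOpen W := (isOpen_pairs hEA hEB hEF u).preimage
    (by fun_prop : Continuous fun τ : ℝ => (t, τ))
  have hsub : Icc 0 t ⊆ W := fun τ hτ => ⟨hTB τ ⟨hτ.1, hτ.2.trans ht.2⟩, hTF t ht τ hτ⟩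
  have hτ : CnOn ℝ 1 (fun τ : ℝ => t - τ) W :=
    (cnOn_const t W).sub (cnOn_clm (ContinuousLinearMap.id ℝ ℝ) W) hW
  have hS := (cnOn_step hEA hEB u).mono (fun τ (h : τ ∈ W) => h.1)
  have hS1 := (cnOn_S1 hB hEA hEB u).mono (fun τ (h : τ ∈ W) => h.1)
  have h1 : CnOn V 1 (fun τ => EF (t - τ) (step EA EB τ u)) W :=
    (hEF.of_le (m := 1) (by norm_num)).cnOn_comp hτ hS hW fun τ h => h.2
  have h2 : CnOn V 1 (fun τ => D (EF (t - τ)) (step EA EB τ u) (S1 A B EA EB τ u)) W :=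
    hEF.cnOn_D hτ hS hS1 hW fun τ h => h.2
  refine ⟨fun τ => D (EF (t - τ)) (step EA EB τ u) (S1 A B EA EB τ u), fun τ₁ hτ₁ => ?_, ?_⟩
  · have hsub' : Icc 0 τ₁ ⊆ W := (Icc_subset_Icc_right hτ₁.2).trans hsub
    have := IsIntegral.of_cnOn hτ₁.1 h2 hsub' fun τ hτ =>
      hasDerivAt_localError_defect hB hEA hEB hEF (hsub' hτ).1 (hsub' hτ).2
    rw [S1_zero hEA hEB, (hEF.cnOn_slice _).D_zero (hEF.isOpen_slice _)
      (hTF t ht 0 ⟨le_rfl, ht.1⟩), sub_zero] at this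
    exact this
  · have := IsIntegral.of_cnOn ht.1 h1 hsub fun τ hτ =>
      hasDerivAt_localError hEA hEB hEF (hsub hτ).1 (hsub hτ).2
    rw [sub_self, hEF.zero, sub_zero, step_zero hEA hEB] at this
    exact this

end LocalError

end StrangSplitting

/-! ### Assembly of the theorem. -/

theorem mainTheorem3 {V : Type*} [AddCommGroup V] [Module ℝ V] [UniformSpace V]
    [IsUniformAddGroup V] [ContinuousSMul ℝ V] [LocallyConvexSpace ℝ V] [T2Space V]
    [CompleteSpace V]
    (A : V →L[ℝ] V) (B : V → V) (hB : StrangSplitting.CnOn V 3 B univ)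
    (EA : ℝ → V →L[ℝ] V) (EB EF : ℝ → V → V) (DomB DomF : Set (ℝ × V))
    (hEA : StrangSplitting.IsFlow 3 (fun x => A x) univ (fun t x => EA t x))
    (hEB : StrangSplitting.IsFlow 3 B DomB EB)
    (hEF : StrangSplitting.IsFlow 2 (StrangSplitting.field A B) DomF EF)
    (u : V) (T : ℝ)
    (hTB : ∀ t ∈ Icc 0 T, (t, EA (t / 2) u) ∈ DomB)
    (hTF : ∀ t ∈ Icc 0 T, ∀ τ ∈ Icc 0 t, (t - τ, StrangSplitting.step EA EB τ u) ∈ DomF) :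
    -- the time derivatives defining the defects exist
    (∀ t ∈ Icc 0 T,
      DifferentiableAt ℝ (fun s : ℝ => StrangSplitting.step EA EB s u) t ∧
      DifferentiableAt ℝ (fun s : ℝ => StrangSplitting.S1 A B EA EB s u) t) ∧
    -- double-integral representation of the local error
    (∀ t ∈ Icc 0 T,
      StrangSplitting.IsDoubleIntegral
        (fun τ₂ =>
          StrangSplitting.D (EF (t - τ₂)) (StrangSplitting.step EA EB τ₂ u)
              (StrangSplitting.S2 A B EA EB τ₂ u)
            + StrangSplitting.D2 (EF (t - τ₂)) (StrangSplitting.step EA EB τ₂ u)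
              (StrangSplitting.S1 A B EA EB τ₂ u) (StrangSplitting.S1 A B EA EB τ₂ u))
        t (StrangSplitting.localError EA EB EF t u) ∧
      ∃ L2 L11 : V,
        StrangSplitting.IsDoubleIntegral
          (fun τ₂ => StrangSplitting.D (EF (t - τ₂)) (StrangSplitting.step EA EB τ₂ u)
            (StrangSplitting.S2 A B EA EB τ₂ u)) t L2 ∧
        StrangSplitting.IsDoubleIntegral
          (fun τ₂ => StrangSplitting.D2 (EF (t - τ₂)) (StrangSplitting.step EA EB τ₂ u)
            (StrangSplitting.S1 A B EA EB τ₂ u) (StrangSplitting.S1 A B EA EB τ₂ u)) t L11 ∧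
        StrangSplitting.localError EA EB EF t u = L2 + L11) ∧
    -- integral representations of the defects
    (∀ t ∈ Icc 0 T,
      StrangSplitting.IsIntegral (fun τ => StrangSplitting.s1 A B EA EB t τ u) 0 t
        (StrangSplitting.S1 A B EA EB t u)) ∧
    (∀ t ∈ Icc 0 T,
      StrangSplitting.IsIntegral (fun τ => StrangSplitting.s2 A B EA EB t τ u) 0 t
        (StrangSplitting.S2 A B EA EB t u)) ∧
    -- orders and leading terms, in every continuous seminorm
    (∀ p : Seminorm ℝ V, Continuous p → ∃ C : ℝ, ∀ t ∈ Icc 0 T,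
      p (StrangSplitting.S1 A B EA EB t u) ≤ C * t ∧
      (∀ τ ∈ Icc 0 t,
        p (StrangSplitting.s2 A B EA EB t τ u - StrangSplitting.leading A B u) ≤ C * t) ∧
      p (StrangSplitting.localError EA EB EF t u
        - (t ^ 3 / 6) • StrangSplitting.leading A B u) ≤ C * t ^ 4) := by

  open StrangSplitting in
  have hS11 : ∀ t ∈ Icc 0 T, ContinuousOn (fun τ₂ => D2 (EF (t - τ₂)) (step EA EB τ₂ u)
      (S1 A B EA EB τ₂ u) (S1 A B EA EB τ₂ u)) (Icc 0 t) := by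
    intro t ht
    let W : Set ℝ := {τ | (t, τ) ∈ {q : ℝ × ℝ | (q.2, EA (q.2 / 2) u) ∈ DomB ∧
      (q.1 - q.2, step EA EB q.2 u) ∈ DomF}}
    have hW : IsOpen W := (isOpen_pairs hEA hEB hEF u).preimage
      (by fun_prop : Continuous fun τ : ℝ => (t, τ))
    have hsub : Icc 0 t ⊆ W := fun τ hτ => ⟨hTB τ ⟨hτ.1, hτ.2.trans ht.2⟩, hTF t ht τ hτ⟩
    have hS1 := (cnOn_S1 hB hEA hEB u).continuousOn.mono (fun τ (h : τ ∈ W) => h.1)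
    have key : ContinuousOn (fun τ₂ => D2 (EF (t - τ₂)) (step EA EB τ₂ u)
        (S1 A B EA EB τ₂ u) (S1 A B EA EB τ₂ u)) W :=
      IsFlow.cnOn_D2 (n := 0) hEF (by fun_prop : Continuous fun τ : ℝ => t - τ).continuousOn
        ((cnOn_step hEA hEB u).continuousOn.mono (fun τ (h : τ ∈ W) => h.1)) hS1 hS1 hW
        fun τ h => h.2
    exact key.mono hsub
  have hL := fun t ht => StrangSplitting.isDoubleIntegral_localError hB hEA hEB hEF hTB hTF
    (t := t) ht
  refine ⟨fun t ht => ⟨HasFDerivAt.differentiableAt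
      (StrangSplitting.hasDerivAt_step hEA hEB (hTB t ht)),
    HasFDerivAt.differentiableAt (StrangSplitting.hasDerivAt_S1 hB hEA hEB (hTB t ht))⟩,
    fun t ht => ⟨hL t ht, ?_⟩,
    fun t ht => StrangSplitting.isIntegral_s1 hB hEA hEB ht.1 (hTB t ht),
    fun t ht => StrangSplitting.isIntegral_s2 hB hEA hEB ht.1 (hTB t ht), fun p hp => ?_⟩
  -- Completeness enters here: the continuous quadratic term has a double integral, and the other
  -- summand then follows by subtraction.
  · obtain ⟨L11, h11⟩ := StrangSplitting.exists_isDoubleIntegral ht.1 (hS11 t ht)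
    refine ⟨_, L11, ((hL t ht).sub h11).congr fun τ _ => ?_, h11, (sub_add_cancel _ _).symm⟩
    exact add_sub_cancel_right _ _
  · obtain ⟨C1, h1, hC1⟩ := StrangSplitting.exists_seminorm_S1_le hB hEA hEB hTB hp
    obtain ⟨C2, h2, hC2⟩ := StrangSplitting.exists_seminorm_s2_sub_le hB hEA hEB hTB hp
    obtain ⟨C3, h3, hC3⟩ := StrangSplitting.exists_seminorm_D_S2_sub_le hB hEA hEB hEF hTB hTF hp
    obtain ⟨C4, h4, hC4⟩ := StrangSplitting.exists_seminorm_D2_S1_le hB hEA hEB hEF hTB hTF hp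
    refine ⟨C1 + C2 + (C3 + C4), fun t ht => ⟨(hC1 t ht).trans ?_,
      fun τ hτ => (hC2 t ht τ hτ).trans ?_, ?_⟩⟩
    · exact mul_le_mul_of_nonneg_right (by linarith) ht.1
    · exact mul_le_mul_of_nonneg_right (by linarith) ht.1
    -- After subtracting `τ ℓ(u)` the integrand is bounded by `(C3 + C4) t²`; double integration
    -- contributes another `t²`.
    · have key := ((hL t ht).sub (StrangSplitting.isDoubleIntegral_smul
        (StrangSplitting.leading A B u) t)).seminorm_le ht.1 hp (c := (C3 + C4) * t ^ 2)
        fun τ hτ => ?_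
      · refine key.trans ?_
        have : 0 ≤ t ^ 4 := by positivity
        nlinarith
      · rw [add_sub_right_comm]
        refine (map_add_le_add p _ _).trans ?_
        have h5 := hC3 t ht τ hτ
        have h6 := hC4 t ht τ hτ
        have h7 : C3 * t * τ ≤ C3 * t ^ 2 := by
          rw [pow_two, ← mul_assoc]
          exact mul_le_mul_of_nonneg_left hτ.2 (mul_nonneg h3 ht.1)
        have h8 : C4 * τ ^ 2 ≤ C4 * t ^ 2 :=
          mul_le_mul_of_nonneg_left (pow_le_pow_left₀ hτ.1 hτ.2 2) h4
        linarith
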